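/- Identify $\mathbb R^2$ with $\mathbb C$. For $\tau\in\mathbb C$ with $\operatorname{Im}\tau>0$ put $\nu_1=\sqrt{2\pi/\operatorname{Im}\tau}$, $\nu_2=\sqrt{2\pi/\operatorname{Im}\tau}\,\tau$, $\mathcal L_\tau=\mathbb Z\nu_1+\mathbb Z\nu_2$, and let $\langle f\rangle$ denote the average of $f$ over the cell $\{u\nu_1+v\nu_2:0\le u,v\le1\}$. Let $\hat{\mathcal L}_\tau$ be the group of characters $\chi:\mathcal L_\tau\to U(1)$. Let $J=\begin{pmatrix}0&1\\-1&0\end{pmatrix}$, $a^0(x)=-\tfrac12Jx$, $\nabla_{a}=\nabla-ia$ and $\Delta_a=\nabla_a\cdot\nabla_a$. For $\chi\in\hat{\mathcal L}_\tau$ let $\phi_\chi:\mathbb R^2\to\mathbb C$ be the solution, unique up to a constant factor of modulus one, of $$(-\Delta_{a^0}-1)\phi=0,\qquad \phi(x+s)=e^{\frac i2 s\cdot Jx}\,(-1)^{mn}\,\chi(s)\,\phi(x)\quad\text{for all } s=m\nu_1+n\nu_2,\ m,n\in\mathbb Z,$$ normalized by $\langle|\phi_\chi|^2\rangle=1$;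 write $\phi_0$ for $\phi_\chi$ with $\chi=1$. Define $$\gamma_\chi(\tau)=2\langle|\phi_0|^2|\phi_\chi|^2\rangle+\bigl|\langle\phi_0^2\,\bar\phi_\chi\,\bar\phi_{\chi^{-1}}\rangle\bigr|-\langle|\phi_0|^4\rangle,\qquad \gamma(\tau)=\inf_{\chi\in\hat{\mathcal L}_\tau}\gamma_\chi(\tau).$$ **Proposition.** (i) For all $\tau$ with $\operatorname{Im}\tau>0$: $\gamma(\tau+1)=\gamma(\tau)$, $\gamma(-1/\tau)=\gamma(\tau)$ and $\gamma(-\bar\tau)=\gamma(\tau)$. In particular $\gamma(g\tau)=\gamma(\tau)$ for all $g\in SL(2,\mathbb Z)$, so $\gamma$ is modular-invariant, and it is symmetric with respect to the imaginary axis. (ii) Let $\tau_0=e^{i\pi/2}$ or $\tau_0=e^{i\pi/3}$. If $\gamma$, as a real function of $(\operatorname{Re}\tau,\operatorname{Im}\tau)$, is differentiable at $\tau_0$, then $\tau_0$ is a critical point of $\gamma$, i.e. the differential of $\gamma$ at $\tau_0$ vanishes. -/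

import Mathlib

namespace Abrikosov

open MeasureTheory

noncomputable section

/-! The plane `ℝ²` is identified with `ℂ` through `(x₁, x₂) ↦ x₁ + i x₂`; the Euclidean dot
product is the real inner product of `ℂ` and the coordinate directions are `1` and `I`. -/

/-- The matrix `J = (0 1; -1 0)` acting on the plane: `(x₁, x₂) ↦ (x₂, -x₁)`. -/
def rotJ (x : ℂ) : ℂ := ⟨x.im, -x.re⟩

/-- The vector potential `a⁰(x) = -½ J x` (constant magnetic field `curl a⁰ = 1`). -/
def vecPot (x : ℂ) : ℂ := -(1 / 2 : ℂ) * rotJ x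

/-- Component in the direction `e` of the covariant gradient `∇_a φ = ∇φ - i a φ`. -/
def covDeriv (a : ℂ → ℂ) (e : ℂ) (φ : ℂ → ℂ) (x : ℂ) : ℂ :=
  fderiv ℝ φ x e - Complex.I * ((inner ℝ (a x) e : ℝ) : ℂ) * φ x

/-- The covariant Laplacian `Δ_a = ∇_a · ∇_a`. -/
def covLaplacian (a : ℂ → ℂ) (φ : ℂ → ℂ) (x : ℂ) : ℂ :=
  covDeriv a 1 (covDeriv a 1 φ) x + covDeriv a Complex.I (covDeriv a Complex.I φ) x

/-- First basis vector `√(2π / Im τ)` of the normalized lattice. -/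
def latticeBasis₁ (τ : ℂ) : ℂ := (Real.sqrt (2 * Real.pi / τ.im) : ℂ)

/-- Second basis vector `√(2π / Im τ) τ` of the normalized lattice. -/
def latticeBasis₂ (τ : ℂ) : ℂ := (Real.sqrt (2 * Real.pi / τ.im) : ℂ) * τ

/-- The point `m ν₁ + n ν₂`. -/
def latticePoint (τ : ℂ) (m n : ℤ) : ℂ := m * latticeBasis₁ τ + n * latticeBasis₂ τ

/-- The lattice `L_τ = √(2π / Im τ) (ℤ + τ ℤ)`, whose cells have area `2π`. -/
def lattice (τ : ℂ) : AddSubgroup ℂ where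
  carrier := {s | ∃ m n : ℤ, latticePoint τ m n = s}
  zero_mem' := ⟨0, 0, by simp [latticePoint]⟩
  add_mem' := by
    rintro _ _ ⟨m, n, rfl⟩ ⟨m', n', rfl⟩
    exact ⟨m + m', n + n', by simp only [latticePoint]; push_cast; ring⟩
  neg_mem' := by
    rintro _ ⟨m, n, rfl⟩
    exact ⟨-m, -n, by simp only [latticePoint]; push_cast; ring⟩

/-- The dual group of `L_τ`: the characters `χ : L_τ → U(1)`. -/
abbrev DualGroup (τ : ℂ) : Type := AddChar (lattice τ) Circle

/-- The fundamental cell `{u ν₁ + v ν₂ : 0 ≤ u, v ≤ 1}` of `L_τ`, representing `ℝ² / L_τ`. -/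
def cell (τ : ℂ) : Set ℂ := parallelepiped ![latticeBasis₁ τ, latticeBasis₂ τ]

/-- `φ` is a normalized solution of the linear problem with character `χ`: it solves
`(-Δ_{a⁰} - 1) φ = 0`, it is gauge-periodic, `φ (x + s) = exp (i (½ s · J x + c_s)) χ(s) φ(x)` for
every `s = m ν₁ + n ν₂` in the lattice, and the average of `|φ|²` over a cell is `1`.

The constants `c_s = π m n` (taken to vanish on the basis `ν₁`, `ν₂`) are forced by the cocycle
condition `c_{s+t} - c_s - c_t - ½ s ∧ t ∈ 2πℤ`: as `ν₁ ∧ ν₂ = 2π`, without them the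
gauge-periodicity relations for `s`, `t` and `s + t` would be compatible only with `φ = 0`. -/
structure IsNormalizedSolution (τ : ℂ) (χ : DualGroup τ) (φ : ℂ → ℂ) : Prop where
  contDiff : ContDiff ℝ 2 φ
  equation : ∀ x, -covLaplacian vecPot φ x - φ x = 0
  gaugePeriodic : ∀ (m n : ℤ) (x : ℂ),
    φ (x + latticePoint τ m n) =
      Complex.exp (Complex.I *
          ((inner ℝ (latticePoint τ m n) (rotJ x) / 2 + Real.pi * m * n : ℝ) : ℂ)) *
        (χ ⟨latticePoint τ m n, m, n, rfl⟩ : ℂ) * φ x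
  normalized : ⨍ x in cell τ, ‖φ x‖ ^ 2 = 1

open Classical in
/-- The normalized solution `φ_χ`. For `Im τ > 0` it exists and is unique up to a constant factor
of modulus one, on which `gammaChi` does not depend. -/
def phi (τ : ℂ) (χ : DualGroup τ) : ℂ → ℂ :=
  if h : ∃ φ, IsNormalizedSolution τ χ φ then h.choose else 0

/-- `γ_χ(τ) = 2 ⟨|φ₀|² |φ_χ|²⟩ + |⟨φ₀² conj(φ_χ) conj(φ_{χ⁻¹})⟩| - ⟨|φ₀|⁴⟩`, where `φ₀` belongs to
the trivial character and `⟨·⟩` is the average over a cell. -/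
def gammaChi (τ : ℂ) (χ : DualGroup τ) : ℝ :=
  2 * (⨍ x in cell τ, ‖phi τ 1 x‖ ^ 2 * ‖phi τ χ x‖ ^ 2)
    + ‖⨍ x in cell τ, phi τ 1 x ^ 2 * (starRingEnd ℂ) (phi τ χ x) *
        (starRingEnd ℂ) (phi τ χ⁻¹ x)‖
    - ⨍ x in cell τ, ‖phi τ 1 x‖ ^ 4

/-- `γ(τ) = inf_χ γ_χ(τ)`, the infimum over all characters; it is used for `Im τ > 0`. -/
def gamma (τ : ℂ) : ℝ := ⨅ χ : DualGroup τ, gammaChi τ χ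

end

end Abrikosov

/-!
Writing `φ = exp (-|z|² / 4) f`, the equation becomes `2 ∂∂̄f = z̄ ∂̄f`, so that the complex
conjugate of `∂̄f` times `exp (-|z|² / 2)` is entire; by gauge periodicity it vanishes at infinity,
hence `∂̄f = 0`. For the trivial character, `exp (-z² / 4) f` satisfies, in the coordinate with
periods `1` and `τ`, the functional equation of the Jacobi theta function, and its Fourier
coefficients on the real line show that it is a multiple of it. Magnetic translations carry any
multipliers compatible with the magnetic field to any others, so for all of them the solution is
unique up to a constant.

By the same translations, `γ_χ` may be computed from any such multipliers `μ`, with solutions for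
`μ`, `μ χ` and `μ χ⁻¹`. An isometry of the plane mapping `L_τ'` onto `L_τ` pulls solutions back to
solutions (after complex conjugation, if it reverses orientation) and permutes the characters,
whence `γ(τ') = γ(τ)`. At `i` and at `e^{iπ/3}` the invariance of `γ` under `z ↦ k - 1/z`, with
`k = 0` and `k = 1`, leaves its differential unchanged by a nontrivial rotation, so it vanishes.
-/

namespace Abrikosov

open Complex Filter MeasureTheory Topology

open scoped ComplexConjugate Pointwise Real

noncomputable section

theorem intervalIntegral_comp_add_of_periodic {h : ℂ → ℂ} (hd : Differentiable ℂ h)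
    (hper : Function.Periodic h 1) (w : ℂ) :
    ∫ x in (0 : ℝ)..1, h (x + w) = ∫ x in (0 : ℝ)..1, h x := by
  have hvertical : ∀ y : ℝ, h (1 + y * I) = h (y * I) := fun y => by rw [add_comm, hper]
  have hrect : ∫ x in (0 : ℝ)..1, h x = ∫ x in (0 : ℝ)..1, h (x + w.im * I) := by
    have := integral_boundary_rect_eq_zero_of_differentiableOn h 0 (1 + w.im * I)
      hd.differentiableOn
    simpa [hvertical, sub_eq_zero] using this
  have hline : Function.Periodic (fun x : ℝ => h (x + w.im * I)) 1 := fun x => by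
    simpa [add_right_comm] using hper (x + w.im * I)
  calc ∫ x in (0 : ℝ)..1, h (x + w)
      = ∫ x in (0 : ℝ)..1, h ((x + w.re : ℝ) + w.im * I) := by
        congr! 3 with x
        rw [ofReal_add, add_assoc, re_add_im]
    _ = ∫ x in w.re..w.re + 1, h (x + w.im * I) := by
        rw [intervalIntegral.integral_comp_add_right (fun x : ℝ => h (x + w.im * I)), zero_add,
          add_comm 1]
    _ = ∫ x in (0 : ℝ)..1, h x := by rw [hline.intervalIntegral_add_eq w.re 0, zero_add, hrect]

/-- The `n`-th Fourier coefficient of the restriction to the real line of a function on `ℂ` of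
period one. -/
def fourierMode (k : ℂ → ℂ) (n : ℤ) : ℂ :=
  ∫ x in (0 : ℝ)..1, exp (-(2 * π * I * n * x)) * k x

theorem hasSum_fourierMode {k : ℂ → ℂ} (hk : Continuous k) (hper : Function.Periodic k 1)
    (hs : Summable (fourierMode k)) (x : ℝ) :
    HasSum (fun n => fourierMode k n * exp (2 * π * I * n * x)) (k x) := by
  have : Fact (0 < (1 : ℝ)) := ⟨one_pos⟩
  have hreal : Function.Periodic (fun y : ℝ => k y) 1 := fun y => by
    simpa using hper y
  let F : C(AddCircle (1 : ℝ), ℂ) :=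
    ⟨hreal.lift, continuous_quot_lift _ (hk.comp continuous_ofReal)⟩
  have hF : ∀ y : ℝ, F y = k y := hreal.lift_coe
  have hcoeff : fourierCoeff F = fourierMode k := by
    funext n
    rw [fourierCoeff_eq_intervalIntegral F n 0]
    simp only [fourierMode, hF, fourier_coe_apply, smul_eq_mul, one_div, zero_add, inv_one,
      one_smul]
    refine intervalIntegral.integral_congr fun y _ => ?_
    simp
  have := has_pointwise_sum_fourier_series_of_summable (f := F) (hcoeff ▸ hs) x
  simpa [hcoeff, hF, fourier_coe_apply] using this

section Quasiperiodic

variable {k : ℂ → ℂ} {τ : ℂ} (hk : Differentiable ℂ k) (h1 : Function.Periodic k 1)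
  (hτk : ∀ w, k (w + τ) = exp (-π * I * (τ + 2 * w)) * k w)
include hk h1 hτk

theorem fourierMode_succ (n : ℤ) :
    fourierMode k (n + 1) = exp (π * I * (2 * n + 1) * τ) * fourierMode k n := by
  have hper : Function.Periodic (fun w => exp (-(2 * π * I * n * w)) * k w) 1 := fun w => by
    dsimp only
    rw [h1, mul_add, neg_add, exp_add,
      show -(2 * π * I * n * 1) = (-n : ℤ) * (2 * π * I) by push_cast; ring,
      exp_int_mul_two_pi_mul_I, mul_one]
  rw [fourierMode, fourierMode, ← intervalIntegral_comp_add_of_periodic (by fun_prop) hper τ,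
    ← intervalIntegral.integral_const_mul]
  refine intervalIntegral.integral_congr fun x _ => ?_
  rw [hτk, ← mul_assoc, ← mul_assoc, ← exp_add, ← exp_add]
  congr 2
  push_cast
  ring

theorem fourierMode_eq (n : ℤ) :
    fourierMode k n = exp (π * I * n ^ 2 * τ) * fourierMode k 0 := by
  have hsucc : ∀ m : ℤ, exp (π * I * (m + 1 : ℤ) ^ 2 * τ) =
      exp (π * I * (2 * m + 1) * τ) * exp (π * I * m ^ 2 * τ) := fun m => by
    rw [← exp_add]
    congr 1
    push_cast
    ring
  induction n using Int.induction_on with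
  | zero => simp
  | succ n ih => rw [fourierMode_succ hk h1 hτk, ih, hsucc, ← mul_assoc]
  | pred n ih =>
    generalize hm : -(n : ℤ) - 1 = m
    rw [show -(n : ℤ) = m + 1 by omega, fourierMode_succ hk h1 hτk, hsucc,
      mul_assoc (exp _)] at ih
    exact mul_left_cancel₀ (exp_ne_zero _) ih

theorem eq_fourierMode_mul_jacobiTheta₂ (hτ : 0 < τ.im) (w : ℂ) :
    k w = fourierMode k 0 * jacobiTheta₂ w τ := by
  have hmode : ∀ n (x : ℂ), fourierMode k n * exp (2 * π * I * n * x) =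
      fourierMode k 0 * jacobiTheta₂_term n x τ := fun n x => by
    rw [fourierMode_eq hk h1 hτk n, jacobiTheta₂_term, exp_add]
    ring
  have hs : Summable (fourierMode k) := by
    have := ((summable_jacobiTheta₂_term_iff 0 τ).2 hτ).mul_left (fourierMode k 0)
    simpa [← hmode] using this
  have hreal : ∀ x : ℝ, k x = fourierMode k 0 * jacobiTheta₂ x τ := fun x => by
    refine (hasSum_fourierMode hk.continuous h1 hs x).unique ?_
    simpa only [hmode] using (hasSum_jacobiTheta₂_term x hτ).mul_left (fourierMode k 0)
  have htheta : Differentiable ℂ fun z => fourierMode k 0 * jacobiTheta₂ z τ := fun z =>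
    (differentiableAt_jacobiTheta₂_fst z hτ).const_mul _
  have hfreq : ∃ᶠ z in 𝓝[≠] (0 : ℂ), k z = fourierMode k 0 * jacobiTheta₂ z τ := by
    have : Tendsto ((↑) : ℝ → ℂ) (𝓝[≠] 0) (𝓝[≠] 0) :=
      (continuous_ofReal.tendsto' 0 0 ofReal_zero).inf
        (tendsto_principal_principal.2 fun _ => ofReal_ne_zero.2)
    exact this.frequently (Frequently.of_forall hreal)
  exact congrFun (AnalyticOnNhd.eq_of_frequently_eq (fun z _ => hk.analyticAt z)
    (fun z _ => htheta.analyticAt z) hfreq) w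

end Quasiperiodic

theorem fourierMode_jacobiTheta₂_zero {τ : ℂ} (hτ : 0 < τ.im) :
    fourierMode (jacobiTheta₂ · τ) 0 = 1 := by
  have hterm : ∀ n : ℤ, ∫ x in (0 : ℝ)..1, jacobiTheta₂_term n x τ = if n = 0 then 1 else 0 := by
    intro n
    split_ifs with hn
    · simp [jacobiTheta₂_term, hn]
    · have h2 : (2 * π * I * n : ℂ) ≠ 0 := by simp [hn, Real.pi_ne_zero]
      simp only [jacobiTheta₂_term, exp_add, intervalIntegral.integral_mul_const,
        integral_exp_mul_complex h2]
      rw [ofReal_one, mul_one, mul_comm (2 * π * I : ℂ), exp_int_mul_two_pi_mul_I]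
      simp
  have hsum : HasSum (fun n : ℤ => ∫ x in (0 : ℝ)..1, jacobiTheta₂_term n x τ)
      (∫ x in (0 : ℝ)..1, jacobiTheta₂ x τ) := by
    have hnorm : ∀ n (x : ℝ), ‖jacobiTheta₂_term n x τ‖ = ‖jacobiTheta₂_term n 0 τ‖ := by
      simp [norm_jacobiTheta₂_term]
    refine intervalIntegral.hasSum_integral_of_dominated_convergence
      (fun n _ => ‖jacobiTheta₂_term n 0 τ‖) (fun n => ?_)
      (fun n => .of_forall fun x _ => (hnorm n x).le)
      (.of_forall fun _ _ => ((summable_jacobiTheta₂_term_iff 0 τ).2 hτ).norm)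
      intervalIntegrable_const
      (.of_forall fun x _ => hasSum_jacobiTheta₂_term x hτ)
    unfold jacobiTheta₂_term
    exact Continuous.aestronglyMeasurable (by fun_prop)
  simp only [hterm] at hsum
  simpa [fourierMode] using hsum.unique (hasSum_ite_eq 0 1)

attribute [local instance] Complex.finrank_real_complex_fact

/-- The area form `s ∧ x = s · J x` of the plane. -/
abbrev wedge : ℂ →ₗ[ℝ] ℂ →ₗ[ℝ] ℝ := Complex.orientation.areaForm

theorem wedge_self (s : ℂ) : wedge s s = 0 := Orientation.areaForm_apply_self _ s

theorem wedge_swap (s x : ℂ) : wedge s x = -wedge x s := Orientation.areaForm_swap _ s x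

theorem inner_rotJ (s x : ℂ) : inner ℝ s (rotJ x) = wedge s x := by
  simp only [rotJ, Complex.inner, Complex.areaForm, mul_re, mul_im, conj_re, conj_im]
  ring

theorem I_mul_wedge (s x : ℂ) : I * (wedge s x : ℂ) = (conj s * x - s * conj x) / 2 := by
  have := sub_conj (conj s * x)
  rw [map_mul, conj_conj] at this
  rw [this, Complex.areaForm]
  push_cast
  ring

theorem wedge_unit_mul (u : Circle) (s x : ℂ) : wedge (u * s) (u * x) = wedge s x := by
  have : conj (u * s) * (u * x) = conj s * x := by
    rw [map_mul, ← Circle.coe_inv_eq_conj, Circle.coe_inv]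
    field_simp
  simp only [Complex.areaForm, this]

theorem wedge_conj (s x : ℂ) : wedge (conj s) (conj x) = -wedge s x := by
  rw [Complex.areaForm, Complex.areaForm, ← map_mul, conj_im]

/-- The phase `exp (i/2 s · J x)` of the gauge-periodicity relation. -/
def gaugePhase (s x : ℂ) : Circle := Circle.exp (wedge s x / 2)

theorem gaugePhase_zero_left (x : ℂ) : gaugePhase 0 x = 1 := by
  simp only [gaugePhase, map_zero, LinearMap.zero_apply, zero_div, Circle.exp_zero]

theorem gaugePhase_add_left (s t x : ℂ) :
    gaugePhase (s + t) x = gaugePhase s x * gaugePhase t x := by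
  simp only [gaugePhase, map_add, LinearMap.add_apply, add_div, Circle.exp_add]

theorem gaugePhase_add_right (s x y : ℂ) :
    gaugePhase s (x + y) = gaugePhase s x * gaugePhase s y := by
  simp only [gaugePhase, map_add, add_div, Circle.exp_add]

theorem gaugePhase_swap (s x : ℂ) : gaugePhase s x = (gaugePhase x s)⁻¹ := by
  rw [gaugePhase, gaugePhase, wedge_swap, neg_div, Circle.exp_neg]

theorem gaugePhase_unit_mul (u : Circle) (s x : ℂ) :
    gaugePhase (u * s) (u * x) = gaugePhase s x := by
  rw [gaugePhase, wedge_unit_mul, gaugePhase]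

theorem gaugePhase_conj (s x : ℂ) : gaugePhase (conj s) (conj x) = (gaugePhase s x)⁻¹ := by
  rw [gaugePhase, wedge_conj, neg_div, Circle.exp_neg, gaugePhase]

theorem coe_gaugePhase (s x : ℂ) :
    (gaugePhase s x : ℂ) = exp ((conj s * x - s * conj x) / 4) := by
  rw [gaugePhase, Circle.coe_exp]
  congr 1
  push_cast
  linear_combination I_mul_wedge s x / 2

section Lattice

variable {τ : ℂ}

/-- The scale `√(2π / Im τ)`, which gives the lattice cells area `2π`. -/
def latticeScale (τ : ℂ) : ℝ := √(2 * π / τ.im)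

theorem latticeScale_pos (hτ : 0 < τ.im) : 0 < latticeScale τ :=
  Real.sqrt_pos.2 (by positivity)

theorem latticeScale_ne_zero (hτ : 0 < τ.im) : (latticeScale τ : ℂ) ≠ 0 :=
  ofReal_ne_zero.2 (latticeScale_pos hτ).ne'

theorem latticeScale_sq (hτ : 0 < τ.im) : latticeScale τ ^ 2 * τ.im = 2 * π := by
  rw [latticeScale, Real.sq_sqrt (by positivity)]
  field_simp

theorem latticeBasis₁_eq : latticeBasis₁ τ = latticeScale τ := rfl

theorem latticeBasis₂_eq : latticeBasis₂ τ = latticeScale τ * τ := rfl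

theorem latticePoint_eq_smul (m n : ℤ) :
    latticePoint τ m n = (m : ℝ) • latticeBasis₁ τ + (n : ℝ) • latticeBasis₂ τ := by
  simp [latticePoint]

theorem wedge_latticeBasis (hτ : 0 < τ.im) :
    wedge (latticeBasis₁ τ) (latticeBasis₂ τ) = 2 * π := by
  have : wedge (latticeBasis₁ τ) (latticeBasis₂ τ) = latticeScale τ ^ 2 * τ.im := by
    rw [latticeBasis₁_eq, latticeBasis₂_eq, Complex.areaForm, conj_ofReal, im_ofReal_mul,
      im_ofReal_mul, sq, mul_assoc]
  rw [this, latticeScale_sq hτ]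

theorem wedge_smul_latticeBasis (hτ : 0 < τ.im) (a b c d : ℝ) :
    wedge (a • latticeBasis₁ τ + b • latticeBasis₂ τ) (c • latticeBasis₁ τ + d • latticeBasis₂ τ) =
      2 * π * (a * d - b * c) := by
  simp only [map_add, map_smul, LinearMap.add_apply, LinearMap.smul_apply, wedge_self,
    wedge_swap (latticeBasis₂ τ) (latticeBasis₁ τ), wedge_latticeBasis hτ, smul_eq_mul]
  ring

/-- The basis vector `ν₁` as an element of the lattice. -/
def latticeVec₁ (τ : ℂ) : lattice τ := ⟨latticeBasis₁ τ, 1, 0, by simp [latticePoint]⟩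

/-- The basis vector `ν₂` as an element of the lattice. -/
def latticeVec₂ (τ : ℂ) : lattice τ := ⟨latticeBasis₂ τ, 0, 1, by simp [latticePoint]⟩

theorem exists_eq_zsmul_add_zsmul (s : lattice τ) :
    ∃ m n : ℤ, s = m • latticeVec₁ τ + n • latticeVec₂ τ := by
  obtain ⟨_, m, n, rfl⟩ := s
  exact ⟨m, n, Subtype.ext (by simp [latticePoint, latticeVec₁, latticeVec₂])⟩

theorem dualGroup_ext {χ χ' : DualGroup τ} (h₁ : χ (latticeVec₁ τ) = χ' (latticeVec₁ τ))
    (h₂ : χ (latticeVec₂ τ) = χ' (latticeVec₂ τ)) : χ = χ' := by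
  ext s
  obtain ⟨m, n, rfl⟩ := exists_eq_zsmul_add_zsmul s
  simp only [AddChar.map_add_eq_mul, AddChar.map_zsmul_eq_zpow, h₁, h₂]

theorem exists_gaugePhase_sq_eq (hτ : 0 < τ.im) (χ : DualGroup τ) :
    ∃ t, ∀ s : lattice τ, gaugePhase s t ^ 2 = χ s := by
  have hexp : ∀ s t, gaugePhase s t ^ 2 = Circle.exp (wedge s t) := fun s t => by
    rw [gaugePhase, sq, ← Circle.exp_add, add_halves]
  let ψ (t : ℂ) : DualGroup τ := {
    toFun s := gaugePhase s t ^ 2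
    map_zero_eq_one' := by simp [hexp]
    map_add_eq_mul' s s' := by
      rw [AddSubgroup.coe_add, gaugePhase_add_left, mul_pow] }
  obtain ⟨α, hα⟩ := Circle.exp_surjective (χ (latticeVec₁ τ))
  obtain ⟨β, hβ⟩ := Circle.exp_surjective (χ (latticeVec₂ τ))
  have h₁ := fun c d => wedge_smul_latticeBasis hτ 1 0 c d
  have h₂ := fun c d => wedge_smul_latticeBasis hτ 0 1 c d
  refine ⟨(-β / (2 * π)) • latticeBasis₁ τ + (α / (2 * π)) • latticeBasis₂ τ,
    fun s => DFunLike.congr_fun (dualGroup_ext (χ := ψ _) ?_ ?_) s⟩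
  · change gaugePhase (latticeBasis₁ τ) _ ^ 2 = _
    rw [← hα, hexp]
    congr 1
    simpa [mul_div_cancel₀, Real.pi_ne_zero] using h₁ (-β / (2 * π)) (α / (2 * π))
  · change gaugePhase (latticeBasis₂ τ) _ ^ 2 = _
    rw [← hβ, hexp]
    congr 1
    have := h₂ (-β / (2 * π)) (α / (2 * π))
    simp only [zero_smul, one_smul, zero_add] at this
    rw [this]
    field_simp
    ring

/-- Multiplier systems compatible with the gauge phases: these are exactly the constants for which
the relations `φ (x + s) = e^{i/2 s · J x} μ(s) φ(x)`, `s ∈ L_τ`, do not force `φ = 0`. -/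
def IsSemicharacter (μ : lattice τ → Circle) : Prop :=
  ∀ s t : lattice τ, μ (s + t) = gaugePhase s t * μ s * μ t

theorem IsSemicharacter.map_zero {μ : lattice τ → Circle} (hμ : IsSemicharacter μ) : μ 0 = 1 := by
  simpa [gaugePhase_zero_left] using hμ 0 0

theorem IsSemicharacter.mul_char {μ : lattice τ → Circle} (hμ : IsSemicharacter μ)
    (χ : DualGroup τ) : IsSemicharacter fun s => μ s * χ s := fun s t => by
  simp only [hμ s t, AddChar.map_add_eq_mul]
  ac_rfl

theorem IsSemicharacter.exists_eq_mul_gaugePhase_sq (hτ : 0 < τ.im) {μ μ' : lattice τ → Circle}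
    (hμ : IsSemicharacter μ) (hμ' : IsSemicharacter μ') :
    ∃ t, ∀ s : lattice τ, μ' s = μ s * gaugePhase s t ^ 2 := by
  obtain ⟨t, ht⟩ := exists_gaugePhase_sq_eq hτ {
    toFun s := μ' s / μ s
    map_zero_eq_one' := by rw [hμ'.map_zero, hμ.map_zero, div_one]
    map_add_eq_mul' s s' := by
      rw [hμ, hμ', mul_assoc, mul_assoc, mul_div_mul_left_eq_div, mul_div_mul_comm] }
  exact ⟨t, fun s => by rw [ht, AddChar.coe_mk, mul_div_cancel]⟩

/-- The sign `(-1)^(mn)` of `s = m ν₁ + n ν₂`, written in terms of `s ∧ ν₂ = 2π m` and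
`ν₁ ∧ s = 2π n`. -/
def latticeSign (τ s : ℂ) : Circle :=
  Circle.exp (wedge s (latticeBasis₂ τ) * wedge (latticeBasis₁ τ) s / (4 * π))

theorem latticeSign_latticeBasis₁ : latticeSign τ (latticeBasis₁ τ) = 1 := by
  rw [latticeSign, wedge_self, mul_zero, zero_div, Circle.exp_zero]

theorem latticeSign_latticeBasis₂ : latticeSign τ (latticeBasis₂ τ) = 1 := by
  rw [latticeSign, wedge_self, zero_mul, zero_div, Circle.exp_zero]

theorem latticeSign_latticePoint (hτ : 0 < τ.im) (m n : ℤ) :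
    latticeSign τ (latticePoint τ m n) = Circle.exp (π * m * n) := by
  have h₁ := wedge_smul_latticeBasis hτ 1 0 m n
  have h₂ := wedge_smul_latticeBasis hτ m n 0 1
  simp only [zero_smul, one_smul, zero_add, add_zero] at h₁ h₂
  rw [latticeSign, latticePoint_eq_smul, h₁, h₂]
  congr 1
  field_simp
  ring

theorem isSemicharacter_latticeSign (hτ : 0 < τ.im) :
    IsSemicharacter fun s : lattice τ => latticeSign τ s := by
  intro s t
  obtain ⟨m, n, hs⟩ := s.2
  obtain ⟨m', n', ht⟩ := t.2
  have hadd : latticePoint τ m n + latticePoint τ m' n' = latticePoint τ (m + m') (n + n') := by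
    simp only [latticePoint]
    push_cast
    ring
  have hphase : gaugePhase (latticePoint τ m n) (latticePoint τ m' n') =
      Circle.exp (π * (m * n' - n * m')) := by
    rw [gaugePhase, latticePoint_eq_smul, latticePoint_eq_smul, wedge_smul_latticeBasis hτ]
    congr 1
    ring
  simp only [AddSubgroup.coe_add, ← hs, ← ht, hadd, hphase, latticeSign_latticePoint hτ,
    ← Circle.exp_add, Circle.exp_eq_exp]
  exact ⟨m' * n, by push_cast; ring⟩

/-- The multipliers `(-1)^(mn) χ(m ν₁ + n ν₂)` of the linear problem. -/
def multiplier (τ : ℂ) (χ : DualGroup τ) (s : lattice τ) : Circle := latticeSign τ s * χ s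

theorem multiplier_one : multiplier τ 1 = fun s : lattice τ => latticeSign τ s :=
  funext fun s => by rw [multiplier, AddChar.one_apply, mul_one]

theorem isSemicharacter_multiplier (hτ : 0 < τ.im) (χ : DualGroup τ) :
    IsSemicharacter (multiplier τ χ) :=
  (isSemicharacter_latticeSign hτ).mul_char χ

end Lattice

section Averages

variable {τ τ' : ℂ}

theorem linearIndependent_latticeBasis (hτ : 0 < τ.im) :
    LinearIndependent ℝ ![latticeBasis₁ τ, latticeBasis₂ τ] := by
  rw [LinearIndependent.pair_iff]
  intro a b h
  have hwedge := wedge_smul_latticeBasis hτ a b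
  rw [h] at hwedge
  exact ⟨by simpa [Real.pi_ne_zero] using hwedge 0 1, by simpa [Real.pi_ne_zero] using hwedge 1 0⟩

/-- The real basis `ν₁, ν₂` of the plane. -/
def periodBasis (hτ : 0 < τ.im) : Module.Basis (Fin 2) ℝ ℂ :=
  basisOfLinearIndependentOfCardEqFinrank (linearIndependent_latticeBasis hτ)
    (by simp [Complex.finrank_real_complex])

theorem coe_periodBasis (hτ : 0 < τ.im) :
    ⇑(periodBasis hτ) = ![latticeBasis₁ τ, latticeBasis₂ τ] :=
  coe_basisOfLinearIndependentOfCardEqFinrank _ _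

theorem span_range_periodBasis (hτ : 0 < τ.im) :
    (Submodule.span ℤ (Set.range (periodBasis hτ))).toAddSubgroup = lattice τ := by
  ext s
  rw [Submodule.mem_toAddSubgroup, coe_periodBasis, Matrix.range_cons, Matrix.range_cons,
    Matrix.range_empty, Set.union_empty, Set.singleton_union, Submodule.mem_span_pair]
  simp only [zsmul_eq_mul]
  rfl

theorem exists_bound_of_periodic (hτ : 0 < τ.im) {P : ℂ → ℝ} (hP : Continuous P)
    (hper : ∀ s : lattice τ, Function.Periodic P s) : ∃ C, ∀ x, P x ≤ C := by
  obtain ⟨C, hC⟩ := (isCompact_closedBall (0 : ℂ) (∑ i, ‖periodBasis hτ i‖)).bddAbove_image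
    hP.continuousOn
  refine ⟨C, fun x => ?_⟩
  have hmem : (ZSpan.floor (periodBasis hτ) x : ℂ) ∈ lattice τ :=
    span_range_periodBasis hτ ▸ (ZSpan.floor (periodBasis hτ) x).2
  rw [← (hper ⟨_, hmem⟩).sub_eq x, ← ZSpan.fract_apply]
  exact hC ⟨_, by simpa using ZSpan.norm_fract_le (periodBasis hτ) x, rfl⟩

instance (τ : ℂ) : Countable (lattice τ) :=
  have hsub : (lattice τ : Set ℂ) ⊆ Set.range fun p : ℤ × ℤ => latticePoint τ p.1 p.2 :=
    fun _ ⟨m, n, hs⟩ => ⟨(m, n), hs⟩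
  ((Set.countable_range _).mono hsub).to_subtype

theorem isAddFundamentalDomain_cell (hτ : 0 < τ.im) :
    IsAddFundamentalDomain (lattice τ) (cell τ) := by
  have hD : IsAddFundamentalDomain (lattice τ) (ZSpan.fundamentalDomain (periodBasis hτ)) :=
    span_range_periodBasis hτ ▸ ZSpan.isAddFundamentalDomain' (periodBasis hτ) volume
  have hae : ZSpan.fundamentalDomain (periodBasis hτ) =ᵐ[volume] cell τ := by
    rw [cell, ← coe_periodBasis hτ]
    exact ZSpan.fundamentalDomain_ae_parallelepiped _ _
  have hsub : ZSpan.fundamentalDomain (periodBasis hτ) ⊆ cell τ := by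
    rw [cell, ← coe_periodBasis hτ]
    exact ZSpan.fundamentalDomain_subset_parallelepiped _
  have hvadd : ∀ s : lattice τ,
      (s +ᵥ ZSpan.fundamentalDomain (periodBasis hτ) : Set ℂ) =ᵐ[volume] (s +ᵥ cell τ : Set ℂ) :=
    fun s => (vadd_set_ae_eq s).2 hae
  exact {
    nullMeasurableSet := hD.nullMeasurableSet.congr hae
    ae_covers := hD.ae_covers.mono fun x ⟨s, hs⟩ => ⟨s, hsub hs⟩
    aedisjoint := fun s t hst => (hD.aedisjoint hst).congr (hvadd s).symm (hvadd t).symm }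

theorem setAverage_cell_pos (hτ : 0 < τ.im) {P : ℂ → ℝ} (hP : Continuous P)
    (hper : ∀ s : lattice τ, Function.Periodic P s) (hnonneg : 0 ≤ P) (hne : P ≠ 0) :
    0 < ⨍ x in cell τ, P x := by
  have hcompact : IsCompact (cell τ) := isCompact_Icc.image (by fun_prop)
  have hsupport : 0 < volume (Function.support P ∩ cell τ) := by
    rw [pos_iff_ne_zero]
    intro hzero
    have hinv : ∀ s : lattice τ, s +ᵥ Function.support P = Function.support P := fun s => by
      ext x
      rw [Set.mem_vadd_set_iff_neg_vadd_mem, Function.mem_support, Function.mem_support,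
        ← hper s, AddSubgroup.vadd_def, AddSubgroup.coe_neg, vadd_eq_add, neg_add_cancel_comm]
    have := (isAddFundamentalDomain_cell hτ).measure_zero_of_invariant _ hinv hzero
    rw [hP.isOpen_support.measure_eq_zero_iff volume, Function.support_eq_empty_iff] at this
    exact hne this
  have hvol : volume (cell τ) ≠ 0 := fun h => hsupport.ne' (measure_inter_null_of_null_right _ h)
  rw [setAverage_eq, smul_eq_mul]
  refine mul_pos (inv_pos.2 (ENNReal.toReal_pos hvol hcompact.measure_ne_top)) ?_
  rwa [setIntegral_pos_iff_support_of_nonneg_ae (.of_forall hnonneg)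
    (hP.continuousOn.integrableOn_compact hcompact)]

/-- The isomorphism of lattices induced by an isometry of the plane that identifies them. -/
def latticeEquiv (A : ℂ ≃ₗᵢ[ℝ] ℂ) (hA : ∀ s, s ∈ lattice τ' ↔ A s ∈ lattice τ) :
    lattice τ' ≃+ lattice τ where
  toEquiv := A.toEquiv.subtypeEquiv hA
  map_add' s t := Subtype.ext (map_add A (s : ℂ) t)

theorem coe_latticeEquiv (A : ℂ ≃ₗᵢ[ℝ] ℂ) (hA : ∀ s, s ∈ lattice τ' ↔ A s ∈ lattice τ)
    (s : lattice τ') : (latticeEquiv A hA s : ℂ) = A s := rfl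

variable {E : Type*} [NormedAddCommGroup E] [NormedSpace ℝ E]

theorem setIntegral_cell_comp (hτ : 0 < τ.im) (hτ' : 0 < τ'.im) (A : ℂ ≃ₗᵢ[ℝ] ℂ)
    (hA : ∀ s, s ∈ lattice τ' ↔ A s ∈ lattice τ) (t : ℂ) {F : ℂ → E}
    (hF : ∀ s : lattice τ, Function.Periodic F s) :
    ∫ x in cell τ', F (A x + t) = ∫ x in cell τ, F x := by
  have hmp : MeasurePreserving (fun x => A x + t) volume volume :=
    (measurePreserving_add_right volume t).comp A.measurePreserving
  have hemb : MeasurableEmbedding fun x => A x + t :=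
    (measurableEmbedding_addRight t).comp A.toHomeomorph.measurableEmbedding
  have hpre : IsAddFundamentalDomain (lattice τ') ((fun x => A x + t) ⁻¹' cell τ) :=
    (isAddFundamentalDomain_cell hτ).preimage_of_equiv hmp.quasiMeasurePreserving
      (latticeEquiv A hA).symm.bijective fun s x => by
        have hs : A ((latticeEquiv A hA).symm s) = s := by
          rw [← coe_latticeEquiv A hA, AddEquiv.apply_symm_apply]
        simp only [AddSubgroup.vadd_def, vadd_eq_add, map_add, hs, add_assoc]
  rw [← hmp.setIntegral_preimage_emb hemb F]
  refine (isAddFundamentalDomain_cell hτ').setIntegral_eq hpre fun s x => ?_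
  rw [AddSubgroup.vadd_def, vadd_eq_add, map_add, add_assoc, add_comm]
  exact hF (latticeEquiv A hA s) _

theorem setAverage_cell_comp (hτ : 0 < τ.im) (hτ' : 0 < τ'.im) (A : ℂ ≃ₗᵢ[ℝ] ℂ)
    (hA : ∀ s, s ∈ lattice τ' ↔ A s ∈ lattice τ) (t : ℂ) {F : ℂ → E}
    (hF : ∀ s : lattice τ, Function.Periodic F s) :
    ⨍ x in cell τ', F (A x + t) = ⨍ x in cell τ, F x := by
  have hvol : volume.real (cell τ') = volume.real (cell τ) := by
    simpa using setIntegral_cell_comp hτ hτ' A hA t (F := fun _ => (1 : ℝ)) fun _ _ => rfl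
  rw [setAverage_eq, setAverage_eq, setIntegral_cell_comp hτ hτ' A hA t hF, hvol]

end Averages

section LowestLandauLevel

variable {f g : ℂ → ℂ} {x : ℂ}

/-- Twice the Wirtinger derivative `∂f/∂z̄`. -/
def dbar (f : ℂ → ℂ) (x : ℂ) : ℂ := fderiv ℝ f x 1 + I * fderiv ℝ f x I

/-- Twice the Wirtinger derivative `∂f/∂z`. -/
def dz (f : ℂ → ℂ) (x : ℂ) : ℂ := fderiv ℝ f x 1 - I * fderiv ℝ f x I

theorem differentiableAt_complex_iff_dbar_eq_zero :
    DifferentiableAt ℂ f x ↔ DifferentiableAt ℝ f x ∧ dbar f x = 0 := by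
  rw [differentiableAt_complex_iff_differentiableAt_real, smul_eq_mul, dbar]
  refine and_congr_right fun _ => ⟨fun h => ?_, fun h => ?_⟩
  · linear_combination I * h + fderiv ℝ f x 1 * I_sq
  · linear_combination -I * h + fderiv ℝ f x I * I_sq

theorem dbar_mul (hf : DifferentiableAt ℝ f x) (hg : DifferentiableAt ℝ g x) :
    dbar (fun y => f y * g y) x = dbar f x * g x + f x * dbar g x := by
  simp only [dbar, fderiv_fun_mul hf hg, add_apply, smul_apply, smul_eq_mul]
  ring

theorem dbar_conj (hf : DifferentiableAt ℝ f x) :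
    dbar (fun y => conj (f y)) x = conj (dz f x) := by
  have : HasFDerivAt (fun y => conj (f y))
      ((conjCLE : ℂ →L[ℝ] ℂ).comp (fderiv ℝ f x)) x :=
    conjCLE.hasFDerivAt.comp x hf.hasFDerivAt
  simp [dbar, dz, this.fderiv]

theorem contDiff_fderiv_apply (hf : ContDiff ℝ 2 f) (e : ℂ) :
    ContDiff ℝ 1 (fun y => fderiv ℝ f y e) :=
  (hf.fderiv_right (by norm_num)).clm_apply contDiff_const

theorem contDiff_dbar (hf : ContDiff ℝ 2 f) : ContDiff ℝ 1 (dbar f) :=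
  (contDiff_fderiv_apply hf 1).add (contDiff_const.mul (contDiff_fderiv_apply hf I))

theorem dz_dbar (hf : ContDiff ℝ 2 f) (x : ℂ) :
    dz (dbar f) x =
      fderiv ℝ (fun y => fderiv ℝ f y 1) x 1 + fderiv ℝ (fun y => fderiv ℝ f y I) x I := by
  have hdiff : ∀ e, DifferentiableAt ℝ (fun y => fderiv ℝ f y e) x := fun e =>
    (contDiff_fderiv_apply hf e).differentiable one_ne_zero x
  have hfderiv : ∀ e, fderiv ℝ (dbar f) x e =
      fderiv ℝ (fun y => fderiv ℝ f y 1) x e + I * fderiv ℝ (fun y => fderiv ℝ f y I) x e := by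
    intro e
    unfold dbar
    rw [fderiv_fun_add (hdiff 1) ((hdiff I).const_mul I), fderiv_const_mul (hdiff I)]
    rfl
  have hsymm : fderiv ℝ (fun y => fderiv ℝ f y 1) x I = fderiv ℝ (fun y => fderiv ℝ f y I) x 1 := by
    have hd : DifferentiableAt ℝ (fderiv ℝ f) x :=
      (hf.fderiv_right (m := 1) (by norm_num)).differentiable one_ne_zero x
    have hconst : ∀ e : ℂ, DifferentiableAt ℝ (fun _ => e) x := fun e => differentiableAt_const e
    rw [fderiv_clm_apply hd (hconst 1), fderiv_clm_apply hd (hconst I)]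
    simpa using (hf.contDiffAt (x := x)).isSymmSndFDerivAt (by simp) I 1
  rw [dz, hfderiv, hfderiv, hsymm]
  linear_combination -fderiv ℝ (fun y => fderiv ℝ f y I) x I * I_sq

theorem hasFDerivAt_exp_mul_conj (c x : ℂ) :
    HasFDerivAt (fun y : ℂ => exp (c * (y * conj y)))
      (exp (c * (x * conj x)) • (c • (x • (conjCLE : ℂ →L[ℝ] ℂ) +
        conj x • ContinuousLinearMap.id ℝ ℂ))) x :=
  (((hasFDerivAt_id (𝕜 := ℝ) x).mul conjCLE.hasFDerivAt).const_mul c).cexp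

theorem dbar_exp_mul_conj (c x : ℂ) :
    dbar (fun y => exp (c * (y * conj y))) x = 2 * c * x * exp (c * (x * conj x)) := by
  rw [dbar, (hasFDerivAt_exp_mul_conj c x).fderiv]
  simp only [smul_add, add_apply, smul_apply, ContinuousLinearEquiv.coe_coe,
    ContinuousAlgEquiv.coeCLE_apply, conjCAE_apply, map_one, smul_eq_mul,
    ContinuousLinearMap.id_apply, conj_I]
  linear_combination (exp (c * (x * conj x)) * c * (conj x - x)) * I_sq

/-- The Gaussian weight `exp (-|x|² / 4)`, as a complex-valued function. -/
def gaussWeight (x : ℂ) : ℂ := exp (-1 / 4 * (x * conj x))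

theorem gaussWeight_ne_zero (x : ℂ) : gaussWeight x ≠ 0 := exp_ne_zero _

theorem contDiff_gaussWeight : ContDiff ℝ 2 gaussWeight :=
  (contDiff_const.mul (contDiff_id.mul conjCLE.contDiff)).cexp

theorem norm_gaussWeight (x : ℂ) : ‖gaussWeight x‖ = Real.exp (-‖x‖ ^ 2 / 4) := by
  rw [gaussWeight, norm_exp, mul_conj, normSq_eq_norm_sq,
    show -1 / 4 * ((‖x‖ ^ 2 : ℝ) : ℂ) = (-‖x‖ ^ 2 / 4 : ℝ) by push_cast; ring, ofReal_re]

/-- The function `f` in the factorization `φ = exp (-|x|² / 4) f`; it is entire exactly when `φ`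
belongs to the lowest Landau level. -/
def entirePart (φ : ℂ → ℂ) (x : ℂ) : ℂ := (gaussWeight x)⁻¹ * φ x

theorem gaussWeight_mul_entirePart (φ : ℂ → ℂ) (x : ℂ) : gaussWeight x * entirePart φ x = φ x :=
  mul_inv_cancel_left₀ (gaussWeight_ne_zero x) _

theorem entirePart_gaussWeight_mul (f : ℂ → ℂ) : entirePart (fun x => gaussWeight x * f x) = f :=
  funext fun x => inv_mul_cancel_left₀ (gaussWeight_ne_zero x) _

theorem contDiff_entirePart {φ : ℂ → ℂ} (hφ : ContDiff ℝ 2 φ) : ContDiff ℝ 2 (entirePart φ) :=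
  (contDiff_gaussWeight.inv gaussWeight_ne_zero).mul hφ

theorem covDeriv_gaussWeight_mul (hf : DifferentiableAt ℝ f x) (e : ℂ) :
    covDeriv vecPot e (fun y => gaussWeight y * f y) x =
      gaussWeight x * (fderiv ℝ f x e - e * conj x / 2 * f x) := by
  have hpot : I * ((inner ℝ (vecPot x) e : ℝ) : ℂ) = -(conj e * x - e * conj x) / 4 := by
    have hwedge : inner ℝ (vecPot x) e = -(1 / 2) * wedge e x := by
      rw [show vecPot x = (-(1 / 2) : ℝ) • rotJ x by rw [vecPot, real_smul]; push_cast; rfl,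
        real_inner_smul_left, real_inner_comm, inner_rotJ]
    rw [hwedge]
    push_cast
    linear_combination -(1 / 2) * I_mul_wedge e x
  have hgauss : HasFDerivAt gaussWeight _ x := hasFDerivAt_exp_mul_conj (-1 / 4) x
  rw [covDeriv, hpot, (hgauss.fun_mul hf.hasFDerivAt).fderiv]
  simp only [gaussWeight, smul_add, add_apply, smul_apply, smul_eq_mul,
    ContinuousLinearEquiv.coe_coe, ContinuousAlgEquiv.coeCLE_apply, conjCAE_apply,
    ContinuousLinearMap.id_apply]
  ring

theorem covDeriv_covDeriv_gaussWeight_mul (hf : ContDiff ℝ 2 f) (e x : ℂ) :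
    covDeriv vecPot e (covDeriv vecPot e fun y => gaussWeight y * f y) x =
      gaussWeight x * (fderiv ℝ (fun y => fderiv ℝ f y e) x e - e * conj x * fderiv ℝ f x e +
        (e ^ 2 * conj x ^ 2 / 4 - e * conj e / 2) * f x) := by
  have hfd : Differentiable ℝ f := hf.differentiable two_ne_zero
  have hfe : DifferentiableAt ℝ (fun y => fderiv ℝ f y e) x :=
    (contDiff_fderiv_apply hf e).differentiable one_ne_zero x
  have hpot : HasFDerivAt (fun y => e * conj y / 2 * f y)
      ((e * conj x / 2) • fderiv ℝ f x + f x • ((e / 2) • (conjCLE : ℂ →L[ℝ] ℂ))) x := by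
    simp only [mul_div_right_comm e]
    exact (conjCLE.hasFDerivAt.const_mul (e / 2)).mul (hfd x).hasFDerivAt
  simp only [funext fun y => covDeriv_gaussWeight_mul (hfd y) e]
  rw [covDeriv_gaussWeight_mul (hfe.fun_sub hpot.differentiableAt),
    (hfe.hasFDerivAt.fun_sub hpot).fderiv]
  congr 1
  simp only [sub_apply, add_apply, smul_apply, smul_eq_mul, ContinuousLinearEquiv.coe_coe,
    ContinuousAlgEquiv.coeCLE_apply, conjCAE_apply]
  ring

theorem neg_covLaplacian_sub_gaussWeight_mul (hf : ContDiff ℝ 2 f) (x : ℂ) :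
    -covLaplacian vecPot (fun y => gaussWeight y * f y) x - gaussWeight x * f x =
      gaussWeight x * (conj x * dbar f x - dz (dbar f) x) := by
  rw [covLaplacian, covDeriv_covDeriv_gaussWeight_mul hf, covDeriv_covDeriv_gaussWeight_mul hf,
    dz_dbar hf, dbar, map_one (starRingEnd ℂ), conj_I]
  linear_combination (-(gaussWeight x * f x) * (1 / 2 + conj x ^ 2 / 4)) * I_sq

theorem eq_zero_of_dz_eq_conj_mul {h : ℂ → ℂ} (hh : Differentiable ℝ h)
    (hdz : ∀ x, dz h x = conj x * h x) {C : ℝ} (hC : ∀ x, ‖gaussWeight x * h x‖ ≤ C) (x : ℂ) :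
    h x = 0 := by
  -- `exp (-|x|² / 2) conj h` is entire and vanishes at infinity.
  have hentire : Differentiable ℂ fun x => exp (-1 / 2 * (x * conj x)) * conj (h x) := fun x => by
    have hexp := (hasFDerivAt_exp_mul_conj (-1 / 2) x).differentiableAt
    have hconj : DifferentiableAt ℝ (fun y => conj (h y)) x :=
      conjCLE.differentiableAt.comp x (hh x)
    refine differentiableAt_complex_iff_dbar_eq_zero.2 ⟨hexp.mul hconj, ?_⟩
    rw [dbar_mul hexp hconj, dbar_exp_mul_conj, dbar_conj (hh x), hdz, map_mul, conj_conj]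
    ring
  have hdecay : Tendsto (fun x : ℂ => Real.exp (-‖x‖ ^ 2 / 4) * C) (cocompact ℂ) (𝓝 0) := by
    have hsq : Tendsto (fun x : ℂ => ‖x‖ ^ 2) (cocompact ℂ) atTop :=
      (tendsto_pow_atTop two_ne_zero).comp tendsto_norm_cocompact_atTop
    simpa using (Real.tendsto_exp_atBot.comp
      ((tendsto_neg_atTop_atBot.comp hsq).atBot_div_const four_pos)).mul_const C
  have hlim : Tendsto (fun x => exp (-1 / 2 * (x * conj x)) * conj (h x)) (cocompact ℂ) (𝓝 0) := by
    refine squeeze_zero_norm (fun y => ?_) hdecay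
    have hsplit : exp (-1 / 2 * (y * conj y)) = gaussWeight y * gaussWeight y := by
      rw [gaussWeight, ← exp_add]
      ring_nf
    rw [hsplit, mul_assoc, norm_mul, norm_gaussWeight, norm_mul, RCLike.norm_conj, ← norm_mul]
    gcongr
    exact hC y
  simpa [exp_ne_zero] using hentire.apply_eq_of_tendsto_cocompact x hlim

end LowestLandauLevel

section LinearProblem

variable {τ : ℂ} {μ : lattice τ → Circle} {φ : ℂ → ℂ}

/-- The gauge-periodicity relation with multipliers `μ`. -/
def IsGaugePeriodic (τ : ℂ) (μ : lattice τ → Circle) (φ : ℂ → ℂ) : Prop :=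
  ∀ (s : lattice τ) x, φ (x + s) = gaugePhase s x * μ s * φ x

theorem IsGaugePeriodic.norm_periodic (h : IsGaugePeriodic τ μ φ) (s : lattice τ) :
    Function.Periodic (fun x => ‖φ x‖) s := fun x => by
  simp only [h s x, norm_mul, Circle.norm_coe, one_mul]

theorem IsGaugePeriodic.exists_norm_le (hτ : 0 < τ.im) (h : IsGaugePeriodic τ μ φ)
    (hφ : Continuous φ) : ∃ C, ∀ x, ‖φ x‖ ≤ C :=
  exists_bound_of_periodic hτ hφ.norm h.norm_periodic

/-- The factor of automorphy to which the phase of the gauge-periodicity relation amounts for the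
entire parts of the functions. -/
def automorphyFactor (s x : ℂ) : ℂ := exp (s * conj s / 4 + conj s / 2 * x)

theorem automorphyFactor_ne_zero (s x : ℂ) : automorphyFactor s x ≠ 0 := exp_ne_zero _

theorem differentiable_automorphyFactor (s : ℂ) : Differentiable ℂ (automorphyFactor s) :=
  ((differentiable_id.const_mul _).const_add _).cexp

theorem gaussWeight_add_mul_automorphyFactor (s x : ℂ) :
    gaussWeight (x + s) * automorphyFactor s x = gaugePhase s x * gaussWeight x := by
  rw [gaussWeight, gaussWeight, automorphyFactor, coe_gaugePhase, ← exp_add, ← exp_add, map_add]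
  ring_nf

theorem gaussWeight_mul_add_eq_iff {f : ℂ → ℂ} {c s x : ℂ} :
    gaussWeight (x + s) * f (x + s) = gaugePhase s x * c * (gaussWeight x * f x) ↔
      f (x + s) = automorphyFactor s x * c * f x := by
  have hweight : gaugePhase s x * c * (gaussWeight x * f x) =
      gaussWeight (x + s) * (automorphyFactor s x * c * f x) := by
    linear_combination -(c * f x) * gaussWeight_add_mul_automorphyFactor s x
  rw [hweight, mul_right_inj' (gaussWeight_ne_zero _)]

theorem isGaugePeriodic_gaussWeight_mul_iff {f : ℂ → ℂ} :
    IsGaugePeriodic τ μ (fun x => gaussWeight x * f x) ↔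
      ∀ (s : lattice τ) x, f (x + s) = automorphyFactor s x * μ s * f x :=
  forall₂_congr fun _ _ => gaussWeight_mul_add_eq_iff

theorem IsGaugePeriodic.gaussWeight_mul_dbar {f : ℂ → ℂ} (hf : Differentiable ℝ f)
    (h : IsGaugePeriodic τ μ fun x => gaussWeight x * f x) :
    IsGaugePeriodic τ μ fun x => gaussWeight x * dbar f x := by
  rw [isGaugePeriodic_gaussWeight_mul_iff] at h ⊢
  intro s x
  have hfactor := (differentiable_automorphyFactor s).mul_const (μ s : ℂ) x
  have hdbar : dbar (fun y => f (y + s)) x = dbar f (x + s) := by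
    simp only [dbar, fderiv_comp_add_right]
  rw [← hdbar, funext (h s), dbar_mul (hfactor.restrictScalars ℝ) (hf x),
    (differentiableAt_complex_iff_dbar_eq_zero.1 hfactor).2, zero_mul, zero_add]

/-- The theta functions of `L_τ` with multipliers `μ`: the gauge-periodic functions in the lowest
Landau level. -/
structure IsThetaFunction (τ : ℂ) (μ : lattice τ → Circle) (φ : ℂ → ℂ) : Prop where
  differentiable : Differentiable ℂ (entirePart φ)
  gaugePeriodic : IsGaugePeriodic τ μ φ

theorem isThetaFunction_iff :
    IsThetaFunction τ μ φ ↔ Differentiable ℂ (entirePart φ) ∧ IsGaugePeriodic τ μ φ :=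
  ⟨fun h => ⟨h.1, h.2⟩, fun h => ⟨h.1, h.2⟩⟩

theorem IsThetaFunction.contDiff (hφ : IsThetaFunction τ μ φ) : ContDiff ℝ 2 φ := by
  rw [← funext (gaussWeight_mul_entirePart φ)]
  exact contDiff_gaussWeight.mul (hφ.differentiable.contDiff.restrict_scalars ℝ)

theorem covLaplacian_eq_iff_differentiable_entirePart (hτ : 0 < τ.im) (hφ : ContDiff ℝ 2 φ)
    (hper : IsGaugePeriodic τ μ φ) :
    (∀ x, -covLaplacian vecPot φ x - φ x = 0) ↔ Differentiable ℂ (entirePart φ) := by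
  obtain ⟨f, rfl⟩ : ∃ f, (fun x => gaussWeight x * f x) = φ :=
    ⟨entirePart φ, funext (gaussWeight_mul_entirePart φ)⟩
  rw [entirePart_gaussWeight_mul]
  have hf : ContDiff ℝ 2 f := entirePart_gaussWeight_mul f ▸ contDiff_entirePart hφ
  have hfd : Differentiable ℝ f := hf.differentiable two_ne_zero
  simp only [neg_covLaplacian_sub_gaussWeight_mul hf, mul_eq_zero, gaussWeight_ne_zero, false_or,
    sub_eq_zero]
  refine ⟨fun h x => differentiableAt_complex_iff_dbar_eq_zero.2 ⟨hfd x, ?_⟩, fun h => ?_⟩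
  · obtain ⟨C, hC⟩ := (hper.gaussWeight_mul_dbar hfd).exists_norm_le hτ
      (contDiff_gaussWeight.continuous.mul (contDiff_dbar hf).continuous)
    exact eq_zero_of_dz_eq_conj_mul ((contDiff_dbar hf).differentiable one_ne_zero)
      (fun y => (h y).symm) hC x
  · have hdbar : dbar f = 0 := funext fun x => (differentiableAt_complex_iff_dbar_eq_zero.1 (h x)).2
    simp [hdbar, dz]

/-- Theta functions whose squared modulus has cell average `1`. -/
structure IsNormalizedTheta (τ : ℂ) (μ : lattice τ → Circle) (φ : ℂ → ℂ) : Prop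
    extends IsThetaFunction τ μ φ where
  normalized : ⨍ x in cell τ, ‖φ x‖ ^ 2 = 1

theorem isGaugePeriodic_multiplier_iff (hτ : 0 < τ.im) (χ : DualGroup τ) :
    IsGaugePeriodic τ (multiplier τ χ) φ ↔ ∀ (m n : ℤ) (x : ℂ),
      φ (x + latticePoint τ m n) =
        exp (I * ((inner ℝ (latticePoint τ m n) (rotJ x) / 2 + π * m * n : ℝ) : ℂ)) *
          (χ ⟨latticePoint τ m n, m, n, rfl⟩ : ℂ) * φ x := by
  have hfactor : ∀ (m n : ℤ) (x : ℂ),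
      exp (I * ((inner ℝ (latticePoint τ m n) (rotJ x) / 2 + π * m * n : ℝ) : ℂ)) =
        gaugePhase (latticePoint τ m n) x * latticeSign τ (latticePoint τ m n) := fun m n x => by
    rw [inner_rotJ, latticeSign_latticePoint hτ, gaugePhase, ← Circle.coe_mul, ← Circle.exp_add,
      Circle.coe_exp, mul_comm]
  simp only [hfactor]
  refine ⟨fun h m n x => ?_, ?_⟩
  · simpa only [multiplier, Circle.coe_mul, ← mul_assoc] using h ⟨_, m, n, rfl⟩ x
  · rintro h ⟨_, m, n, rfl⟩ x
    simpa only [multiplier, Circle.coe_mul, ← mul_assoc] using h m n x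

theorem isNormalizedSolution_iff (hτ : 0 < τ.im) (χ : DualGroup τ) :
    IsNormalizedSolution τ χ φ ↔ IsNormalizedTheta τ (multiplier τ χ) φ := by
  constructor
  · intro h
    have hper := (isGaugePeriodic_multiplier_iff hτ χ).2 h.gaugePeriodic
    exact ⟨⟨(covLaplacian_eq_iff_differentiable_entirePart hτ h.contDiff hper).1 h.equation, hper⟩,
      h.normalized⟩
  · intro h
    exact ⟨h.contDiff,
      (covLaplacian_eq_iff_differentiable_entirePart hτ h.contDiff h.gaugePeriodic).2
        h.differentiable,
      (isGaugePeriodic_multiplier_iff hτ χ).1 h.gaugePeriodic, h.normalized⟩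

end LinearProblem

section Theta

variable {τ : ℂ} {μ : lattice τ → Circle} {φ : ℂ → ℂ}

/-- The magnetic translation by `t`, which preserves the lowest Landau level. -/
def magneticTranslate (t : ℂ) (φ : ℂ → ℂ) (x : ℂ) : ℂ := gaugePhase x t * φ (x + t)

theorem IsThetaFunction.translate (hφ : IsThetaFunction τ μ φ) (t : ℂ) :
    IsThetaFunction τ (fun s => μ s * gaugePhase s t ^ 2) (magneticTranslate t φ) where
  differentiable := by
    have hentire : entirePart (magneticTranslate t φ) =
        fun x => (automorphyFactor t x)⁻¹ * entirePart φ (x + t) := by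
      funext x
      have hweight := gaussWeight_add_mul_automorphyFactor t x
      have hphase : (gaugePhase x t * gaugePhase t x : ℂ) = 1 := by
        rw [gaugePhase_swap, Circle.coe_inv, inv_mul_cancel₀ (Circle.coe_ne_zero _)]
      rw [entirePart, magneticTranslate, ← gaussWeight_mul_entirePart φ (x + t),
        inv_mul_eq_iff_eq_mul₀ (gaussWeight_ne_zero x)]
      have := automorphyFactor_ne_zero t x
      field_simp
      linear_combination gaugePhase x t * entirePart φ (x + t) * hweight +
        gaussWeight x * entirePart φ (x + t) * hphase
    rw [hentire]
    exact ((differentiable_automorphyFactor t).inv (automorphyFactor_ne_zero t)).mul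
      (hφ.differentiable.comp (differentiable_id.add_const t))
  gaugePeriodic s x := by
    have := hφ.gaugePeriodic s (x + t)
    simp only [magneticTranslate, add_right_comm x (s : ℂ) t, this,
      gaugePhase_add_left, gaugePhase_add_right, Circle.coe_mul, Circle.coe_pow]
    ring

theorem IsSemicharacter.isGaugePeriodic_iff (hμ : IsSemicharacter μ) :
    IsGaugePeriodic τ μ φ ↔
      (∀ x, φ (x + latticeBasis₁ τ) = gaugePhase (latticeBasis₁ τ) x * μ (latticeVec₁ τ) * φ x) ∧
      ∀ x, φ (x + latticeBasis₂ τ) = gaugePhase (latticeBasis₂ τ) x * μ (latticeVec₂ τ) * φ x := by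
  refine ⟨fun h => ⟨h (latticeVec₁ τ), h (latticeVec₂ τ)⟩, fun ⟨h₁, h₂⟩ => ?_⟩
  let H : AddSubgroup (lattice τ) := {
    carrier := {s | ∀ x, φ (x + s) = gaugePhase s x * μ s * φ x}
    zero_mem' x := by
      rw [ZeroMemClass.coe_zero, add_zero, gaugePhase_zero_left, hμ.map_zero, Circle.coe_one,
        one_mul, one_mul]
    add_mem' {s s'} hs hs' x := by
      rw [AddSubgroup.coe_add, add_comm (s : ℂ), ← add_assoc, hs, hs', hμ, gaugePhase_add_left,
        gaugePhase_add_right, gaugePhase_swap]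
      simp only [Circle.coe_mul]
      ring
    neg_mem' {s} hs x := by
      have hphase : gaugePhase (-s : lattice τ) x * μ (-s) * (gaugePhase s (x + -s) * μ s) = 1 := by
        have hcocycle := hμ s (-s)
        rw [add_neg_cancel, hμ.map_zero] at hcocycle
        calc _ = gaugePhase (-s) x * gaugePhase s x * (gaugePhase s (-s) * μ s * μ (-s)) := by
              rw [gaugePhase_add_right, AddSubgroup.coe_neg]
              ac_rfl
          _ = 1 := by
            rw [← gaugePhase_add_left, neg_add_cancel, gaugePhase_zero_left, one_mul, hcocycle]
            rfl
      have := hs (x + -s)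
      rw [neg_add_cancel_right] at this
      rw [this, ← mul_assoc, ← Circle.coe_mul, ← Circle.coe_mul, ← Circle.coe_mul, hphase]
      simp }
  have hvec₁ : latticeVec₁ τ ∈ H := h₁
  have hvec₂ : latticeVec₂ τ ∈ H := h₂
  intro s
  obtain ⟨m, n, rfl⟩ := exists_eq_zsmul_add_zsmul s
  exact H.add_mem (H.zsmul_mem hvec₁ m) (H.zsmul_mem hvec₂ n)

/-- The function of the plane in the lowest Landau level that corresponds to a function `k` of the
coordinate with periods `1` and `τ`. -/
def ofUnitCell (τ : ℂ) (k : ℂ → ℂ) (x : ℂ) : ℂ :=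
  gaussWeight x * (exp (x ^ 2 / 4) * k (x / latticeScale τ))

theorem ofUnitCell_add_iff (hτ : 0 < τ.im) {k : ℂ → ℂ} {a c : ℂ} :
    (∀ x, ofUnitCell τ k (x + latticeScale τ * a) =
        gaugePhase (latticeScale τ * a) x * c * ofUnitCell τ k x) ↔
      ∀ w, k (w + a) = exp (latticeScale τ ^ 2 / 4 * (conj a - a) * (a + 2 * w)) * c * k w := by
  have hr := latticeScale_ne_zero hτ
  rw [(mul_left_surjective₀ hr).forall]
  refine forall_congr' fun w => ?_
  have hexp : automorphyFactor (latticeScale τ * a) (latticeScale τ * w) *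
        exp ((latticeScale τ * w) ^ 2 / 4) =
      exp ((latticeScale τ * (w + a)) ^ 2 / 4) *
        exp (latticeScale τ ^ 2 / 4 * (conj a - a) * (a + 2 * w)) := by
    rw [automorphyFactor, ← exp_add, ← exp_add, map_mul, conj_ofReal]
    ring_nf
  have hfactor : automorphyFactor (latticeScale τ * a) (latticeScale τ * w) * c *
        (exp ((latticeScale τ * w) ^ 2 / 4) * k w) =
      exp ((latticeScale τ * (w + a)) ^ 2 / 4) *
        (exp (latticeScale τ ^ 2 / 4 * (conj a - a) * (a + 2 * w)) * c * k w) := by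
    linear_combination c * k w * hexp
  unfold ofUnitCell
  rw [gaussWeight_mul_add_eq_iff (f := fun x => exp (x ^ 2 / 4) * k (x / latticeScale τ)),
    ← mul_add, mul_div_cancel_left₀ _ hr, mul_div_cancel_left₀ _ hr, hfactor,
    mul_right_inj' (exp_ne_zero _)]

/-- The function of the coordinate with periods `1` and `τ` that corresponds to `φ`; inverse to
`ofUnitCell`. -/
def toUnitCell (τ : ℂ) (φ : ℂ → ℂ) (w : ℂ) : ℂ :=
  (exp ((latticeScale τ * w) ^ 2 / 4))⁻¹ * entirePart φ (latticeScale τ * w)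

theorem toUnitCell_ofUnitCell (hτ : 0 < τ.im) (k : ℂ → ℂ) : toUnitCell τ (ofUnitCell τ k) = k := by
  funext w
  unfold toUnitCell ofUnitCell
  rw [entirePart_gaussWeight_mul, mul_div_cancel_left₀ _ (latticeScale_ne_zero hτ),
    inv_mul_cancel_left₀ (exp_ne_zero _)]

theorem ofUnitCell_toUnitCell (hτ : 0 < τ.im) (φ : ℂ → ℂ) : ofUnitCell τ (toUnitCell τ φ) = φ := by
  funext x
  rw [ofUnitCell, toUnitCell, mul_div_cancel₀ _ (latticeScale_ne_zero hτ),
    mul_inv_cancel_left₀ (exp_ne_zero _), gaussWeight_mul_entirePart]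

theorem differentiable_entirePart_ofUnitCell_iff (hτ : 0 < τ.im) {k : ℂ → ℂ} :
    Differentiable ℂ (entirePart (ofUnitCell τ k)) ↔ Differentiable ℂ k := by
  constructor
  · intro h
    rw [← toUnitCell_ofUnitCell hτ k]
    unfold toUnitCell
    exact Differentiable.mul (by fun_prop (disch := exact fun _ => exp_ne_zero _))
      (h.comp (differentiable_id.const_mul _))
  · intro h
    unfold ofUnitCell
    rw [entirePart_gaussWeight_mul]
    fun_prop

theorem isThetaFunction_ofUnitCell_iff (hτ : 0 < τ.im) {k : ℂ → ℂ} :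
    IsThetaFunction τ (fun s => latticeSign τ s) (ofUnitCell τ k) ↔ Differentiable ℂ k ∧
      Function.Periodic k 1 ∧ ∀ w, k (w + τ) = exp (-π * I * (τ + 2 * w)) * k w := by
  have h₁ := ofUnitCell_add_iff hτ (k := k) (a := 1) (c := 1)
  have h₂ := ofUnitCell_add_iff hτ (k := k) (a := τ) (c := 1)
  have hscale : latticeScale τ ^ 2 / 4 * (conj τ - τ) = -π * I := by
    have hsq : (latticeScale τ : ℂ) ^ 2 * τ.im = 2 * π := mod_cast latticeScale_sq hτ
    have him := sub_conj τ
    rw [ofReal_mul, ofReal_ofNat] at him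
    linear_combination -I / 2 * hsq - latticeScale τ ^ 2 / 4 * him
  simp only [map_one, sub_self, mul_zero, zero_mul, exp_zero, one_mul, mul_one, hscale]
    at h₁ h₂
  rw [← latticeBasis₁_eq] at h₁
  rw [← latticeBasis₂_eq] at h₂
  rw [Function.Periodic, ← differentiable_entirePart_ofUnitCell_iff hτ, ← h₁, ← h₂,
    isThetaFunction_iff, (isSemicharacter_latticeSign hτ).isGaugePeriodic_iff]
  simp [latticeVec₁, latticeVec₂, latticeSign_latticeBasis₁, latticeSign_latticeBasis₂]

theorem isThetaFunction_ofUnitCell_jacobiTheta₂ (hτ : 0 < τ.im) :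
    IsThetaFunction τ (fun s => latticeSign τ s) (ofUnitCell τ (jacobiTheta₂ · τ)) :=
  (isThetaFunction_ofUnitCell_iff hτ).2 ⟨fun z => differentiableAt_jacobiTheta₂_fst z hτ,
    fun z => jacobiTheta₂_add_left z τ, fun z => jacobiTheta₂_add_left' z τ⟩

theorem ofUnitCell_jacobiTheta₂_ne_zero (hτ : 0 < τ.im) : ofUnitCell τ (jacobiTheta₂ · τ) ≠ 0 := by
  intro h
  have hmode := fourierMode_jacobiTheta₂_zero hτ
  rw [← toUnitCell_ofUnitCell hτ (jacobiTheta₂ · τ), h] at hmode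
  simp [fourierMode, toUnitCell, entirePart] at hmode

theorem IsThetaFunction.exists_eq_const_mul_jacobiTheta₂ (hτ : 0 < τ.im)
    (hφ : IsThetaFunction τ (fun s => latticeSign τ s) φ) :
    ∃ c : ℂ, ∀ x, φ x = c * ofUnitCell τ (jacobiTheta₂ · τ) x := by
  rw [← ofUnitCell_toUnitCell hτ φ, isThetaFunction_ofUnitCell_iff hτ] at hφ
  obtain ⟨hk, hk₁, hkτ⟩ := hφ
  refine ⟨fourierMode (toUnitCell τ φ) 0, fun x => ?_⟩
  rw [← ofUnitCell_toUnitCell hτ φ, ofUnitCell,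
    eq_fourierMode_mul_jacobiTheta₂ hk hk₁ hkτ hτ, ofUnitCell, toUnitCell_ofUnitCell hτ]
  ring

end Theta

section GroundStates

variable {τ : ℂ} {μ : lattice τ → Circle} {φ ψ : ℂ → ℂ}

theorem norm_magneticTranslate (t : ℂ) (φ : ℂ → ℂ) (x : ℂ) :
    ‖magneticTranslate t φ x‖ = ‖φ (x + t)‖ := by
  rw [magneticTranslate, norm_mul, Circle.norm_coe, one_mul]

theorem magneticTranslate_ne_zero (t : ℂ) (hφ : φ ≠ 0) : magneticTranslate t φ ≠ 0 := by
  obtain ⟨x, hx⟩ := Function.ne_iff.1 hφ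
  refine Function.ne_iff.2 ⟨x - t, ?_⟩
  rw [Pi.zero_apply, ← norm_ne_zero_iff, norm_magneticTranslate, sub_add_cancel]
  exact norm_ne_zero_iff.2 hx

theorem IsSemicharacter.exists_isThetaFunction (hτ : 0 < τ.im) (hμ : IsSemicharacter μ) :
    ∃ φ, IsThetaFunction τ μ φ ∧ φ ≠ 0 := by
  obtain ⟨t, ht⟩ := (isSemicharacter_latticeSign hτ).exists_eq_mul_gaugePhase_sq hτ hμ
  refine ⟨magneticTranslate t (ofUnitCell τ (jacobiTheta₂ · τ)), ?_,
    magneticTranslate_ne_zero t (ofUnitCell_jacobiTheta₂_ne_zero hτ)⟩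
  rw [funext ht]
  exact (isThetaFunction_ofUnitCell_jacobiTheta₂ hτ).translate t

theorem IsThetaFunction.eq_const_mul (hτ : 0 < τ.im) (hμ : IsSemicharacter μ)
    (hφ : IsThetaFunction τ μ φ) (hψ : IsThetaFunction τ μ ψ) (hφ0 : φ ≠ 0) :
    ∃ c : ℂ, ∀ x, ψ x = c * φ x := by
  obtain ⟨t, ht⟩ := hμ.exists_eq_mul_gaugePhase_sq hτ (isSemicharacter_latticeSign hτ)
  have hφt := hφ.translate t
  have hψt := hψ.translate t
  rw [← funext ht] at hφt hψt
  obtain ⟨a, ha⟩ := hφt.exists_eq_const_mul_jacobiTheta₂ hτ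
  obtain ⟨b, hb⟩ := hψt.exists_eq_const_mul_jacobiTheta₂ hτ
  have ha0 : a ≠ 0 := by
    rintro rfl
    exact magneticTranslate_ne_zero t hφ0 (funext fun x => by rw [ha, zero_mul, Pi.zero_apply])
  refine ⟨b / a, fun x => ?_⟩
  have hx : magneticTranslate t ψ (x - t) = b / a * magneticTranslate t φ (x - t) := by
    rw [ha, hb]
    field_simp
  rw [magneticTranslate, magneticTranslate, sub_add_cancel, mul_left_comm] at hx
  exact mul_left_cancel₀ (Circle.coe_ne_zero _) hx

theorem IsThetaFunction.const_mul (hφ : IsThetaFunction τ μ φ) (c : ℂ) :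
    IsThetaFunction τ μ fun x => c * φ x where
  differentiable := by
    have : entirePart (fun x => c * φ x) = fun x => c * entirePart φ x :=
      funext fun x => mul_left_comm _ _ _
    rw [this]
    exact hφ.differentiable.const_mul c
  gaugePeriodic s x := by
    simp only [hφ.gaugePeriodic s x]
    ring

theorem setAverage_norm_const_mul_sq (c : ℂ) (φ : ℂ → ℂ) :
    ⨍ x in cell τ, ‖c * φ x‖ ^ 2 = ‖c‖ ^ 2 * ⨍ x in cell τ, ‖φ x‖ ^ 2 := by
  simp only [norm_mul, mul_pow, average_eq, integral_const_mul, smul_eq_mul]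
  ring

theorem IsSemicharacter.exists_isNormalizedTheta (hτ : 0 < τ.im) (hμ : IsSemicharacter μ) :
    ∃ φ, IsNormalizedTheta τ μ φ := by
  obtain ⟨φ, hφ, hφ0⟩ := hμ.exists_isThetaFunction hτ
  have hpos : 0 < ⨍ x in cell τ, ‖φ x‖ ^ 2 := by
    refine setAverage_cell_pos hτ (hφ.contDiff.continuous.norm.pow 2)
      (fun s x => congrArg (· ^ 2) (hφ.gaugePeriodic.norm_periodic s x))
      (fun x => sq_nonneg _) fun h => hφ0 (funext fun x => ?_)
    simpa using congrFun h x
  refine ⟨_, hφ.const_mul (√(⨍ x in cell τ, ‖φ x‖ ^ 2))⁻¹, ?_⟩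
  rw [setAverage_norm_const_mul_sq, norm_inv, norm_real, inv_pow, Real.norm_eq_abs, sq_abs,
    Real.sq_sqrt hpos.le, inv_mul_cancel₀ hpos.ne']

theorem IsNormalizedTheta.ne_zero (hφ : IsNormalizedTheta τ μ φ) : φ ≠ 0 := by
  rintro rfl
  simpa using hφ.normalized

theorem IsNormalizedTheta.eq_circle_mul (hτ : 0 < τ.im) (hμ : IsSemicharacter μ)
    (hφ : IsNormalizedTheta τ μ φ) (hψ : IsNormalizedTheta τ μ ψ) :
    ∃ c : Circle, ∀ x, ψ x = c * φ x := by
  obtain ⟨c, hc⟩ := hφ.toIsThetaFunction.eq_const_mul hτ hμ hψ.toIsThetaFunction hφ.ne_zero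
  have hnorm : ‖c‖ ^ 2 = 1 := by
    rw [← hψ.normalized, funext hc, setAverage_norm_const_mul_sq, hφ.normalized, mul_one]
  have hone : ‖c‖ = 1 := (pow_eq_one_iff_of_nonneg (norm_nonneg c) two_ne_zero).1 hnorm
  exact ⟨⟨c, mem_sphere_zero_iff_norm.2 hone⟩, hc⟩

theorem isNormalizedTheta_phi (hτ : 0 < τ.im) (χ : DualGroup τ) :
    IsNormalizedTheta τ (multiplier τ χ) (phi τ χ) := by
  have h : ∃ φ, IsNormalizedSolution τ χ φ :=
    ((isSemicharacter_multiplier hτ χ).exists_isNormalizedTheta hτ).imp fun _ =>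
      (isNormalizedSolution_iff hτ χ).2
  rw [phi, dif_pos h]
  exact (isNormalizedSolution_iff hτ χ).1 h.choose_spec

end GroundStates

section QuarticForm

variable {τ τ' : ℂ} {μ : lattice τ → Circle} {χ : DualGroup τ} {φ₀ φ ψ : ℂ → ℂ}

/-- The combination of quartic cell averages of which `gammaChi` is the value at `φ₀`, `φ_χ` and
`φ_{χ⁻¹}`. -/
def quarticForm (τ : ℂ) (φ₀ φ ψ : ℂ → ℂ) : ℝ :=
  2 * (⨍ x in cell τ, ‖φ₀ x‖ ^ 2 * ‖φ x‖ ^ 2)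
    + ‖⨍ x in cell τ, φ₀ x ^ 2 * conj (φ x) * conj (ψ x)‖
    - ⨍ x in cell τ, ‖φ₀ x‖ ^ 4

theorem quarticForm_circle_mul (c₀ c c' : Circle) :
    quarticForm τ (fun x => c₀ * φ₀ x) (fun x => c * φ x) (fun x => c' * ψ x) =
      quarticForm τ φ₀ φ ψ := by
  have hconst : ∀ x, (c₀ * φ₀ x) ^ 2 * conj (c * φ x) * conj (c' * ψ x) =
      (c₀ ^ 2 * c⁻¹ * c'⁻¹ : Circle) * (φ₀ x ^ 2 * conj (φ x) * conj (ψ x)) := fun x => by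
    simp only [map_mul, Circle.coe_mul, Circle.coe_pow, Circle.coe_inv_eq_conj]
    ring
  simp only [quarticForm, hconst, norm_mul, Circle.norm_coe, one_mul, average_eq,
    integral_const_mul, norm_smul]

theorem quarticForm_conj :
    quarticForm τ (fun x => conj (φ₀ x)) (fun x => conj (φ x)) (fun x => conj (ψ x)) =
      quarticForm τ φ₀ φ ψ := by
  have hconj : ∀ x, conj (φ₀ x) ^ 2 * conj (conj (φ x)) * conj (conj (ψ x)) =
      conj (φ₀ x ^ 2 * conj (φ x) * conj (ψ x)) := fun x => by
    simp only [map_mul, map_pow]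
  simp only [quarticForm, hconj, average_eq, integral_conj, norm_smul, RCLike.norm_conj]

theorem IsGaugePeriodic.sq_mul_conj_mul_conj_periodic (h₀ : IsGaugePeriodic τ μ φ₀)
    (h : IsGaugePeriodic τ (fun s => μ s * χ s) φ)
    (h' : IsGaugePeriodic τ (fun s => μ s * χ⁻¹ s) ψ) (s : lattice τ) :
    Function.Periodic (fun x => φ₀ x ^ 2 * conj (φ x) * conj (ψ x)) s := fun x => by
  have hphase : ((gaugePhase s x * μ s) ^ 2 * (gaugePhase s x * (μ s * χ s))⁻¹ *
      (gaugePhase s x * (μ s * χ⁻¹ s))⁻¹ : Circle) = 1 := by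
    rw [AddChar.inv_apply', ← mul_assoc, ← mul_assoc, mul_assoc, ← mul_inv, mul_mul_mul_comm,
      mul_inv_cancel, mul_one, ← sq, mul_inv_cancel]
  have := congrArg (· * (φ₀ x ^ 2 * conj (φ x) * conj (ψ x))) (congrArg ((↑) : Circle → ℂ) hphase)
  simp only [Circle.coe_mul, Circle.coe_pow, Circle.coe_inv_eq_conj, Circle.coe_one] at this
  simp only [h₀ s x, h s x, h' s x, Circle.coe_mul, map_mul] at this ⊢
  linear_combination this

theorem quarticForm_comp (hτ : 0 < τ.im) (hτ' : 0 < τ'.im) (A : ℂ ≃ₗᵢ[ℝ] ℂ)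
    (hA : ∀ s, s ∈ lattice τ' ↔ A s ∈ lattice τ) (t : ℂ) (p : ℂ → Circle)
    (h₀ : IsGaugePeriodic τ μ φ₀) (h : IsGaugePeriodic τ (fun s => μ s * χ s) φ)
    (h' : IsGaugePeriodic τ (fun s => μ s * χ⁻¹ s) ψ) :
    quarticForm τ' (fun x => p x * φ₀ (A x + t)) (fun x => p x * φ (A x + t))
      (fun x => p x * ψ (A x + t)) = quarticForm τ φ₀ φ ψ := by
  have hcancel : ∀ x, (p x * φ₀ (A x + t)) ^ 2 * conj (p x * φ (A x + t)) *
      conj (p x * ψ (A x + t)) = φ₀ (A x + t) ^ 2 * conj (φ (A x + t)) * conj (ψ (A x + t)) := by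
    intro x
    have hp : (p x * conj (p x : ℂ) : ℂ) = 1 := by
      rw [← Circle.coe_inv_eq_conj, ← Circle.coe_mul, mul_inv_cancel, Circle.coe_one]
    simp only [map_mul]
    linear_combination (φ₀ (A x + t) ^ 2 * conj (φ (A x + t)) * conj (ψ (A x + t))) *
      (p x * conj (p x : ℂ) + 1) * hp
  simp only [quarticForm, hcancel, norm_mul, Circle.norm_coe, one_mul]
  rw [setAverage_cell_comp hτ hτ' A hA t (F := fun x => ‖φ₀ x‖ ^ 2 * ‖φ x‖ ^ 2) fun s x => ?_,
    setAverage_cell_comp hτ hτ' A hA t (h₀.sq_mul_conj_mul_conj_periodic h h'),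
    setAverage_cell_comp hτ hτ' A hA t (F := fun x => ‖φ₀ x‖ ^ 4)
      fun s x => congrArg (· ^ 4) (h₀.norm_periodic s x)]
  exact congrArg₂ (fun a b => a ^ 2 * b ^ 2) (h₀.norm_periodic s x) (h.norm_periodic s x)

theorem IsNormalizedTheta.translate (hτ : 0 < τ.im) (hφ : IsNormalizedTheta τ μ φ) (t : ℂ) :
    IsNormalizedTheta τ (fun s => μ s * gaugePhase s t ^ 2) (magneticTranslate t φ) where
  toIsThetaFunction := hφ.toIsThetaFunction.translate t
  normalized := by
    simp only [norm_magneticTranslate]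
    rw [← hφ.normalized]
    exact setAverage_cell_comp hτ hτ (.refl ℝ ℂ) (fun _ => Iff.rfl) t (F := fun x => ‖φ x‖ ^ 2)
      fun s x => congrArg (· ^ 2) (hφ.gaugePeriodic.norm_periodic s x)

theorem gammaChi_eq_quarticForm (hτ : 0 < τ.im) (hμ : IsSemicharacter μ)
    (h₀ : IsNormalizedTheta τ μ φ₀) (h : IsNormalizedTheta τ (fun s => μ s * χ s) φ)
    (h' : IsNormalizedTheta τ (fun s => μ s * χ⁻¹ s) ψ) :
    gammaChi τ χ = quarticForm τ φ₀ φ ψ := by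
  obtain ⟨t, ht⟩ := (isSemicharacter_latticeSign hτ).exists_eq_mul_gaugePhase_sq hτ hμ
  have hphi : ∀ {η : DualGroup τ} {θ : ℂ → ℂ}, IsNormalizedTheta τ (fun s => μ s * η s) θ →
      ∃ c : Circle, θ = fun x => c * magneticTranslate t (phi τ η) x := fun {η θ} hθ => by
    have hη := (isNormalizedTheta_phi hτ η).translate hτ t
    rw [show (fun s => multiplier τ η s * gaugePhase s t ^ 2) = fun s => μ s * η s by
      funext s; rw [ht, multiplier, mul_right_comm]] at hη
    obtain ⟨c, hc⟩ := hη.eq_circle_mul hτ (hμ.mul_char η) hθ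
    exact ⟨c, funext hc⟩
  obtain ⟨c₀, rfl⟩ := hphi (η := 1) (by simpa only [AddChar.one_apply, mul_one] using h₀)
  obtain ⟨c, rfl⟩ := hphi h
  obtain ⟨c', rfl⟩ := hphi h'
  rw [quarticForm_circle_mul]
  exact (quarticForm_comp hτ hτ (.refl ℝ ℂ) (fun _ => Iff.rfl) t (gaugePhase · t)
    (multiplier_one (τ := τ) ▸ (isNormalizedTheta_phi hτ 1).gaugePeriodic)
    (isNormalizedTheta_phi hτ χ).gaugePeriodic (isNormalizedTheta_phi hτ χ⁻¹).gaugePeriodic).symm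

end QuarticForm

section Invariance

variable {τ τ' : ℂ} {μ : lattice τ → Circle} {φ : ℂ → ℂ}

theorem IsSemicharacter.comp_rotation (hμ : IsSemicharacter μ) (u : Circle)
    (hu : ∀ s, s ∈ lattice τ' ↔ rotation u s ∈ lattice τ) :
    IsSemicharacter fun s => μ (latticeEquiv (rotation u) hu s) := fun s t => by
  simp only [map_add, hμ _ _, coe_latticeEquiv, rotation_apply, gaugePhase_unit_mul]

theorem IsNormalizedTheta.comp_rotation (hτ : 0 < τ.im) (hτ' : 0 < τ'.im)
    (hφ : IsNormalizedTheta τ μ φ) (u : Circle)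
    (hu : ∀ s, s ∈ lattice τ' ↔ rotation u s ∈ lattice τ) :
    IsNormalizedTheta τ' (fun s => μ (latticeEquiv (rotation u) hu s))
      (fun x => φ (rotation u x)) where
  differentiable := by
    have hentire : entirePart (fun x => φ (rotation u x)) = fun x => entirePart φ (u * x) := by
      funext x
      have hnorm : (u * x) * conj (u * x) = x * conj x := by
        simp only [mul_conj, normSq_eq_norm_sq, norm_mul, Circle.norm_coe, one_mul]
      rw [entirePart, entirePart, gaussWeight, gaussWeight, hnorm, rotation_apply]
    rw [hentire]
    exact hφ.differentiable.comp (differentiable_id.const_mul _)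
  gaugePeriodic s x := by
    simpa only [map_add, coe_latticeEquiv, rotation_apply, gaugePhase_unit_mul] using
      hφ.gaugePeriodic (latticeEquiv (rotation u) hu s) (rotation u x)
  normalized := by
    rw [← hφ.normalized]
    simpa only [add_zero] using setAverage_cell_comp hτ hτ' (rotation u) hu 0
      (F := fun x => ‖φ x‖ ^ 2) fun s x => congrArg (· ^ 2) (hφ.gaugePeriodic.norm_periodic s x)

theorem gammaChi_eq_quarticForm_comp (hτ : 0 < τ.im) (hτ' : 0 < τ'.im) (A : ℂ ≃ₗᵢ[ℝ] ℂ)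
    (hA : ∀ s, s ∈ lattice τ' ↔ A s ∈ lattice τ) (χ : DualGroup τ) :
    gammaChi τ χ = quarticForm τ' (fun x => phi τ 1 (A x)) (fun x => phi τ χ (A x))
      (fun x => phi τ χ⁻¹ (A x)) := by
  have := quarticForm_comp hτ hτ' A hA 0 1
    (multiplier_one (τ := τ) ▸ (isNormalizedTheta_phi hτ 1).gaugePeriodic)
    (isNormalizedTheta_phi hτ χ).gaugePeriodic (isNormalizedTheta_phi hτ χ⁻¹).gaugePeriodic
  simp only [Pi.one_apply, Circle.coe_one, one_mul, add_zero] at this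
  exact this.symm

theorem gamma_eq_of_rotation (hτ : 0 < τ.im) (hτ' : 0 < τ'.im) (u : Circle)
    (hu : ∀ s, s ∈ lattice τ' ↔ rotation u s ∈ lattice τ) : gamma τ' = gamma τ := by
  let e := latticeEquiv (rotation u) hu
  let pull : DualGroup τ → DualGroup τ' := fun χ => χ.compAddMonoidHom e.toAddMonoidHom
  have hsurj : Function.Surjective pull := fun χ => ⟨χ.compAddMonoidHom e.symm.toAddMonoidHom,
    DFunLike.ext _ _ fun s => congrArg χ (e.symm_apply_apply s)⟩
  have htheta : ∀ η, IsNormalizedTheta τ' (fun s => latticeSign τ (e s) * pull η s)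
      fun x => phi τ η (rotation u x) := fun η =>
    (isNormalizedTheta_phi hτ η).comp_rotation hτ hτ' u hu
  refine (hsurj.iInf_congr pull fun χ => ?_).symm
  have hinv : pull χ⁻¹ = (pull χ)⁻¹ := DFunLike.ext _ _ fun s => by
    simp only [pull, AddChar.inv_apply', AddChar.compAddMonoidHom_apply]
  rw [gammaChi_eq_quarticForm_comp hτ hτ' (rotation u) hu]
  exact gammaChi_eq_quarticForm hτ' ((isSemicharacter_latticeSign hτ).comp_rotation u hu)
    (by simpa only [pull, AddChar.compAddMonoidHom_apply, AddChar.one_apply, mul_one]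
      using htheta 1)
    (htheta χ) (hinv ▸ htheta χ⁻¹)

theorem IsSemicharacter.comp_conj (hμ : IsSemicharacter μ)
    (hlat : ∀ s, s ∈ lattice τ' ↔ conjLIE s ∈ lattice τ) :
    IsSemicharacter fun s => (μ (latticeEquiv conjLIE hlat s))⁻¹ := fun s t => by
  simp only [map_add, hμ _ _, coe_latticeEquiv, conjLIE_apply, gaugePhase_conj, mul_inv, inv_inv]

theorem IsNormalizedTheta.comp_conj (hτ : 0 < τ.im) (hτ' : 0 < τ'.im)
    (hφ : IsNormalizedTheta τ μ φ) (hlat : ∀ s, s ∈ lattice τ' ↔ conjLIE s ∈ lattice τ) :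
    IsNormalizedTheta τ' (fun s => (μ (latticeEquiv conjLIE hlat s))⁻¹)
      (fun x => conj (φ (conj x))) where
  differentiable := by
    have hentire : entirePart (fun x => conj (φ (conj x))) =
        fun x => conj (entirePart φ (conj x)) := by
      funext x
      simp only [entirePart, gaussWeight, map_mul, map_inv₀, ← exp_conj, conj_conj, map_div₀,
        map_neg, map_one, map_ofNat, mul_comm (conj x) x]
    rw [hentire]
    exact fun x => differentiableAt_conj_conj_iff.2 (hφ.differentiable (conj x))
  gaugePeriodic s x := by
    have := congrArg conj (hφ.gaugePeriodic (latticeEquiv conjLIE hlat s) (conj x))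
    simpa only [map_add, map_mul, coe_latticeEquiv, conjLIE_apply, gaugePhase_conj,
      ← Circle.coe_inv_eq_conj, inv_inv] using this
  normalized := by
    rw [← hφ.normalized]
    simpa only [add_zero, conjLIE_apply, RCLike.norm_conj] using
      setAverage_cell_comp hτ hτ' conjLIE hlat 0 (F := fun x => ‖φ x‖ ^ 2)
        fun s x => congrArg (· ^ 2) (hφ.gaugePeriodic.norm_periodic s x)

theorem gamma_eq_of_conj (hτ : 0 < τ.im) (hτ' : 0 < τ'.im)
    (hlat : ∀ s, s ∈ lattice τ' ↔ conjLIE s ∈ lattice τ) : gamma τ' = gamma τ := by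
  let e := latticeEquiv conjLIE hlat
  let pull : DualGroup τ → DualGroup τ' := fun χ => (χ.compAddMonoidHom e.toAddMonoidHom)⁻¹
  have hpull : ∀ χ s, pull χ s = (χ (e s))⁻¹ := fun χ s => by
    simp only [pull, AddChar.inv_apply', AddChar.compAddMonoidHom_apply]
    rfl
  have hsurj : Function.Surjective pull := fun χ =>
    ⟨(χ.compAddMonoidHom e.symm.toAddMonoidHom)⁻¹, DFunLike.ext _ _ fun s => by
      rw [hpull, AddChar.inv_apply', inv_inv]
      exact congrArg χ (e.symm_apply_apply s)⟩
  have htheta : ∀ η, IsNormalizedTheta τ' (fun s => (latticeSign τ (e s))⁻¹ * pull η s)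
      fun x => conj (phi τ η (conj x)) := fun η => by
    simpa only [hpull, multiplier, mul_inv] using
      (isNormalizedTheta_phi hτ η).comp_conj hτ hτ' hlat
  refine (hsurj.iInf_congr pull fun χ => ?_).symm
  have hinv : pull χ⁻¹ = (pull χ)⁻¹ := DFunLike.ext _ _ fun s => by
    simp only [hpull, AddChar.inv_apply']
  rw [gammaChi_eq_quarticForm_comp hτ hτ' conjLIE hlat, ← quarticForm_conj]
  exact gammaChi_eq_quarticForm hτ' ((isSemicharacter_latticeSign hτ).comp_conj hlat)
    (by simpa only [hpull, AddChar.one_apply, inv_one, mul_one, conjLIE_apply] using htheta 1)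
    (htheta χ) (hinv ▸ htheta χ⁻¹)

theorem gamma_neg_conj (hτ : 0 < τ.im) : gamma (-conj τ) = gamma τ := by
  have hτ' : 0 < (-conj τ).im := by rwa [neg_im, conj_im, neg_neg]
  have hscale : latticeScale (-conj τ) = latticeScale τ := by
    rw [latticeScale, latticeScale, neg_im, conj_im, neg_neg]
  have hconj : ∀ m n : ℤ, conj (latticePoint (-conj τ) m n) = latticePoint τ m (-n) := by
    intro m n
    simp only [latticePoint, latticeBasis₁_eq, latticeBasis₂_eq, hscale, map_add, map_mul, map_neg,
      conj_ofReal, conj_conj, map_intCast]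
    push_cast
    ring
  refine gamma_eq_of_conj hτ hτ' fun s => ⟨?_, fun ⟨m, n, hs⟩ => ⟨m, -n, ?_⟩⟩
  · rintro ⟨m, n, rfl⟩
    exact ⟨m, -n, (hconj m n).symm⟩
  · apply conjLIE.injective
    rw [conjLIE_apply, hconj, neg_neg, hs]

theorem latticeScale_smul (g : Matrix.SpecialLinearGroup (Fin 2) ℤ) (τ : UpperHalfPlane) :
    latticeScale (g • τ : UpperHalfPlane) = latticeScale τ * ‖UpperHalfPlane.denom g τ‖ := by
  have hdenom : 0 < ‖UpperHalfPlane.denom g τ‖ := norm_pos_iff.2 (UpperHalfPlane.denom_ne_zero _ τ)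
  have him : (g • τ : UpperHalfPlane).im = τ.im / ‖UpperHalfPlane.denom g τ‖ ^ 2 := by
    rw [ModularGroup.im_smul_eq_div_normSq, normSq_eq_norm_sq]
  rw [latticeScale, latticeScale, UpperHalfPlane.coe_im, UpperHalfPlane.coe_im, him,
    div_div_eq_mul_div, mul_div_right_comm, Real.sqrt_mul' _ (sq_nonneg _), Real.sqrt_sq hdenom.le]

theorem exists_rotation_latticePoint_smul (g : Matrix.SpecialLinearGroup (Fin 2) ℤ)
    (τ : UpperHalfPlane) : ∃ u : Circle, ∀ m n : ℤ,
      rotation u (latticePoint (g • τ : UpperHalfPlane) m n) =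
        latticePoint τ (m * g 1 1 + n * g 0 1) (m * g 1 0 + n * g 0 0) := by
  refine ⟨Circle.exp (arg (UpperHalfPlane.denom g τ)), fun m n => ?_⟩
  have hdenom := UpperHalfPlane.denom_ne_zero (g : GL (Fin 2) ℝ) τ
  have hpolar := norm_mul_exp_arg_mul_I (UpperHalfPlane.denom g τ)
  have hdenom_eq : UpperHalfPlane.denom g τ = g 1 0 * τ + g 1 1 := ModularGroup.denom_apply g τ
  have hcoe : ((g • τ : UpperHalfPlane) : ℂ) * UpperHalfPlane.denom g τ = g 0 0 * τ + g 0 1 := by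
    rw [UpperHalfPlane.coe_specialLinearGroup_apply]
    simp only [algebraMap_int_eq, eq_intCast, ofReal_intCast]
    rw [← hdenom_eq, div_mul_cancel₀ _ hdenom]
  simp only [latticePoint, latticeBasis₁_eq, latticeBasis₂_eq, latticeScale_smul, rotation_apply,
    Circle.coe_exp, ofReal_mul]
  push_cast
  linear_combination (latticeScale τ * (m + n * (g • τ : UpperHalfPlane)) : ℂ) * hpolar +
    latticeScale τ * m * hdenom_eq + latticeScale τ * n * hcoe

theorem gamma_smul (g : Matrix.SpecialLinearGroup (Fin 2) ℤ) (τ : UpperHalfPlane) :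
    gamma ((g • τ : UpperHalfPlane) : ℂ) = gamma (τ : ℂ) := by
  obtain ⟨u, hu⟩ := exists_rotation_latticePoint_smul g τ
  have hdet : g 0 0 * g 1 1 - g 0 1 * g 1 0 = 1 := by rw [← Matrix.det_fin_two, g.det_coe]
  refine gamma_eq_of_rotation τ.im_pos (g • τ).im_pos u fun s => ⟨?_, fun ⟨m, n, hs⟩ => ?_⟩
  · rintro ⟨m, n, rfl⟩
    exact ⟨_, _, (hu m n).symm⟩
  · refine ⟨m * g 0 0 - n * g 0 1, n * g 1 1 - m * g 1 0, (rotation u).injective ?_⟩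
    rw [hu, ← hs]
    congr 1
    · linear_combination m * hdet
    · linear_combination n * hdet

theorem gamma_add_one (hτ : 0 < τ.im) : gamma (τ + 1) = gamma τ := by
  have := gamma_smul ModularGroup.T ⟨τ, hτ⟩
  rw [UpperHalfPlane.modular_T_smul, UpperHalfPlane.coe_vadd] at this
  simpa only [ofReal_one, UpperHalfPlane.coe_mk, add_comm] using this

theorem gamma_neg_one_div (hτ : 0 < τ.im) : gamma (-1 / τ) = gamma τ := by
  have := gamma_smul ModularGroup.S ⟨τ, hτ⟩
  rwa [UpperHalfPlane.modular_S_smul, UpperHalfPlane.coe_mk, UpperHalfPlane.coe_mk, inv_neg,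
    ← one_div, ← neg_div] at this

end Invariance

section CriticalPoints

theorem hasFDerivAt_zero_of_comp_eq {F : ℂ → ℝ} {σ : ℂ → ℂ} {τ a : ℂ}
    (hF : DifferentiableAt ℝ F τ) (hσ : HasDerivAt σ a τ) (hfix : σ τ = τ) (ha : a ≠ 1)
    (hinv : ∀ᶠ z in 𝓝 τ, F (σ z) = F z) : HasFDerivAt F (0 : ℂ →L[ℝ] ℝ) τ := by
  have hcomp : HasFDerivAt (F ∘ σ) _ τ :=
    (hfix.symm ▸ hF.hasFDerivAt : HasFDerivAt F (fderiv ℝ F τ) (σ τ)).comp τ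
      (hσ.hasFDerivAt.restrictScalars ℝ)
  have hmul : ∀ v, fderiv ℝ F τ (a * v) = fderiv ℝ F τ v := fun v => by
    have := (hcomp.congr_of_eventuallyEq (hinv.mono fun z hz => hz.symm)).unique hF.hasFDerivAt
    simpa [mul_comm] using congrArg (· v) this
  have hzero : fderiv ℝ F τ = 0 := by
    ext1 v
    have hv : v = a * (v / (a - 1)) - v / (a - 1) := by
      rw [← sub_one_mul, mul_div_cancel₀ _ (sub_ne_zero.2 ha)]
    rw [hv, map_sub, hmul, sub_self, zero_apply]
  exact hzero ▸ hF.hasFDerivAt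

theorem gamma_int_sub_inv {z : ℂ} (hz : 0 < z.im) (k : ℤ) : gamma (k - z⁻¹) = gamma z := by
  have hz₀ : z ≠ 0 := fun h => hz.ne' (congrArg im h)
  let g : Matrix.SpecialLinearGroup (Fin 2) ℤ := ⟨!![k, -1; 1, 0], by simp⟩
  have := gamma_smul g ⟨z, hz⟩
  rw [UpperHalfPlane.coe_specialLinearGroup_apply] at this
  simpa [← sub_eq_add_neg, sub_div, hz₀, g] using this

theorem hasFDerivAt_gamma_of_sq_eq {τ : ℂ} (hτ : 0 < τ.im) (k : ℤ) (hk : τ ^ 2 = k * τ - 1)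
    (hγ : DifferentiableAt ℝ gamma τ) : HasFDerivAt gamma (0 : ℂ →L[ℝ] ℝ) τ := by
  have hτ₀ : τ ≠ 0 := fun h => hτ.ne' (congrArg im h)
  have hderiv : HasDerivAt (fun z : ℂ => k - z⁻¹) (τ ^ 2)⁻¹ τ := by
    simpa only [neg_neg] using (hasDerivAt_inv hτ₀).const_sub (k : ℂ)
  have hfix : k - τ⁻¹ = τ := by
    field_simp
    linear_combination -hk
  have hne : (τ ^ 2)⁻¹ ≠ 1 := by
    intro h
    rcases sq_eq_one_iff.1 (inv_eq_one.1 h) with rfl | rfl <;> simp at hτ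
  exact hasFDerivAt_zero_of_comp_eq hγ hderiv hfix hne <|
    (continuous_im.continuousAt.eventually_const_lt hτ).mono fun z hz => gamma_int_sub_inv hz k

theorem exp_I_mul_pi_div_two : exp (I * π / 2) = I := by
  rw [mul_comm, mul_div_right_comm, exp_pi_div_two_mul_I]

theorem exp_I_mul_pi_div_three : exp (I * π / 3) = (1 / 2 : ℝ) + (√3 / 2 : ℝ) * I := by
  rw [show I * π / 3 = ((π / 3 : ℝ) : ℂ) * I by push_cast; ring, exp_mul_I, ← ofReal_cos,
    ← ofReal_sin, Real.cos_pi_div_three, Real.sin_pi_div_three]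

theorem exp_I_mul_pi_div_three_sq : exp (I * π / 3) ^ 2 = exp (I * π / 3) - 1 := by
  have hsqrt : (√3 : ℂ) ^ 2 = 3 := by
    exact_mod_cast congrArg ((↑) : ℝ → ℂ) (Real.sq_sqrt (show (0 : ℝ) ≤ 3 by norm_num))
  rw [exp_I_mul_pi_div_three]
  push_cast
  linear_combination (√3 : ℂ) ^ 2 / 4 * I_sq - hsqrt / 4

theorem hasFDerivAt_gamma_exp {τ : ℂ} (hτ : τ = exp (I * π / 2) ∨ τ = exp (I * π / 3))
    (hγ : DifferentiableAt ℝ gamma τ) : HasFDerivAt gamma (0 : ℂ →L[ℝ] ℝ) τ := by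
  rcases hτ with rfl | rfl
  · have hsq : exp (I * π / 2) ^ 2 = (0 : ℤ) * exp (I * π / 2) - 1 := by
      rw [exp_I_mul_pi_div_two, I_sq, Int.cast_zero, zero_mul, zero_sub]
    exact hasFDerivAt_gamma_of_sq_eq (by simp [exp_I_mul_pi_div_two]) 0 hsq hγ
  · have hsq : exp (I * π / 3) ^ 2 = (1 : ℤ) * exp (I * π / 3) - 1 := by
      rw [Int.cast_one, one_mul, exp_I_mul_pi_div_three_sq]
    exact hasFDerivAt_gamma_of_sq_eq (by simp [exp_I_mul_pi_div_three]) 1 hsq hγ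

end CriticalPoints

end

end Abrikosov

theorem proposition1p3 :
    (∀ τ : ℂ, 0 < τ.im →
      Abrikosov.gamma (τ + 1) = Abrikosov.gamma τ ∧
      Abrikosov.gamma (-1 / τ) = Abrikosov.gamma τ ∧
      Abrikosov.gamma (-(starRingEnd ℂ) τ) = Abrikosov.gamma τ) ∧
    (∀ (g : Matrix.SpecialLinearGroup (Fin 2) ℤ) (τ : UpperHalfPlane),
      Abrikosov.gamma ((g • τ : UpperHalfPlane) : ℂ) = Abrikosov.gamma (τ : ℂ)) ∧
    (∀ τ : ℂ,
      τ = Complex.exp (Complex.I * Real.pi / 2) ∨ τ = Complex.exp (Complex.I * Real.pi / 3) →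
      DifferentiableAt ℝ Abrikosov.gamma τ →
      HasFDerivAt Abrikosov.gamma (0 : ℂ →L[ℝ] ℝ) τ) :=
  ⟨fun _ hτ =>
      ⟨Abrikosov.gamma_add_one hτ, Abrikosov.gamma_neg_one_div hτ, Abrikosov.gamma_neg_conj hτ⟩,
    Abrikosov.gamma_smul, fun _ => Abrikosov.hasFDerivAt_gamma_exp⟩
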